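/- For a simplicial set $S_\bullet$ let $S_k^\circ\subseteq S_k$ be the set of nondegenerate $k$-simplices. Define spans $\zeta^{(k)} = (S_1 \xleftarrow{p_k} M_k \to *)$ as follows: for $k\ge 1$, $M_k = S_k^\circ$ and $p_k = d_1^{\,k-1}$ sends a $k$-simplex to its long edge (the edge from its first to its last vertex); for $k=0$, $M_0=S_0$ and $p_0=s_0$ is the degeneracy map (this span is the unit $\delta$ of the incidence algebra of $S_\bullet$). Let $\Phi_{even}=\sum_{k\ge0}\zeta^{(2k)}$ and $\Phi_{odd}=\sum_{k\ge0}\zeta^{(2k+1)}$, where the sum of spans is the coproduct, and for a span $F=(S_1\xleftarrow{p}M\to *)$ and $s\in S_1$ write $F(s)=p^{-1}(s)$. Put $$E_{even}=\coprod_{s\in S_1}\Phi_{even}(s),\qquad E_{odd}=\coprod_{s\in S_1}\Phi_{odd}(s).$$ Proposition 5.1. Let $X$ be a finite CW complex, and let $S_\bullet=S_\bullet(X)$ be a simplicial set associated to $X$, i.e. a simplicial set with finitely many nondegenerate simplices whose geometric realization is homotopy equivalent to $X$ (for example, homeomorphic to $X$). Then the integral singular homology groups $H_n(X;\mathbb Z)$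 are finitely generated and zero for all but finitely many $n$, the sets $E_{even}(X)=E_{even}$ and $E_{odd}(X)=E_{odd}$ are finite, and the Euler characteristic $\chi(X)=\sum_n(-1)^n\operatorname{rank}H_n(X;\mathbb Z)$ satisfies $$\chi(X)=|E_{even}(X)|-|E_{odd}(X)|.$$ -/

import Mathlib

open CategoryTheory

/-- The set `S_n` of `n`-simplices of a simplicial set `S`. -/
abbrev Simplices (S : SSet.{0}) (n : ℕ) : Type :=
  S.obj (Opposite.op (SimplexCategory.mk n))

/-- A linear functional in objective linear algebra on the objective vector space with basis `B`:
a span `B ← M → *`. For `B = S₁` these are the elements of the incidence algebra `I(S)`. -/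
structure ObjFunctional (B : Type) where
  /-- the apex `M` of the span -/
  apex : Type
  /-- the left leg `p : M → B` of the span -/
  leg : apex → B

namespace ObjFunctional

/-- The fibre `F(b) = p⁻¹(b)` of a span `B ← M → *` with left leg `p`. -/
def fibre {B : Type} (F : ObjFunctional B) (b : B) : Type :=
  {m : F.apex // F.leg m = b}

/-- The sum of a family of objective functionals: the coproduct of the spans. -/
def sum {B ι : Type} (F : ι → ObjFunctional B) : ObjFunctional B where
  apex := Σ i, (F i).apex
  leg x := (F x.1).leg x.2

/-- The space `∐_{b ∈ B} F(b)` assembled from all the fibres of `F`. -/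
def total {B : Type} (F : ObjFunctional B) : Type :=
  Σ b : B, F.fibre b

end ObjFunctional

/-- The iterated inner face map `S_{k+1} → S_1`, applying the face map `d₁` exactly `k` times;
it sends a simplex to its long edge, from the first vertex to the last one. -/
def longEdge (S : SSet.{0}) : (k : ℕ) → Simplices S (k + 1) → Simplices S 1
  | 0, x => x
  | k + 1, x => longEdge S k (S.δ (1 : Fin (k + 3)) x)

/-- The functional `ζ^{(k)}` in the incidence algebra of `S`: for `k ≥ 1` it is the span
`S₁ ← S_k° → *` on the set `S_k°` of nondegenerate `k`-simplices, with the long edge map as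
left leg; for `k = 0` it is the unit `δ` of the convolution, the span `S₁ ← S₀ → *` whose left leg
is the degeneracy map `s₀`. -/
def zetaNondeg (S : SSet.{0}) : ℕ → ObjFunctional (Simplices S 1)
  | 0 => { apex := Simplices S 0, leg := fun x => S.σ (0 : Fin 1) x }
  | k + 1 => { apex := S.nonDegenerate (k + 1), leg := fun x => longEdge S k x.1 }

/-- The even objective Möbius functor `Φ_even = ∑_{k ≥ 0} ζ^{(2k)}`. -/
def PhiEven (S : SSet.{0}) : ObjFunctional (Simplices S 1) :=
  ObjFunctional.sum fun k : ℕ => zetaNondeg S (2 * k)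

/-- The odd objective Möbius functor `Φ_odd = ∑_{k ≥ 0} ζ^{(2k+1)}`. -/
def PhiOdd (S : SSet.{0}) : ObjFunctional (Simplices S 1) :=
  ObjFunctional.sum fun k : ℕ => zetaNondeg S (2 * k + 1)

/-- `E_even = ∐_{s ∈ S₁} Φ_even(s)`. -/
def EEven (S : SSet.{0}) : Type := (PhiEven S).total

/-- `E_odd = ∐_{s ∈ S₁} Φ_odd(s)`. -/
def EOdd (S : SSet.{0}) : Type := (PhiOdd S).total

/-- The singular chain complex of a space with integer coefficients. -/
noncomputable def singularChains (X : Type) [TopologicalSpace X] :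
    ChainComplex (ModuleCat.{0} ℤ) ℕ :=
  ((AlgebraicTopology.singularChainComplexFunctor (ModuleCat.{0} ℤ)).obj
    (ModuleCat.of ℤ ℤ)).obj (TopCat.of X)

/-- The singular homology group `H_n(X; ℤ)`. -/
noncomputable def singularH (X : Type) [TopologicalSpace X] (n : ℕ) : ModuleCat.{0} ℤ :=
  (singularChains X).homology n

/-- The Euler characteristic of `X` is defined: the groups `H_n(X; ℤ)` are finitely generated, and
all but finitely many of them are zero. -/
def HasEulerChar (X : Type) [TopologicalSpace X] : Prop :=
  (∀ n, Module.Finite ℤ (singularH X n)) ∧ {n | Nontrivial (singularH X n)}.Finite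

/-- The Euler characteristic `χ(X) = ∑_n (-1)^n rank H_n(X; ℤ)`. It is meaningful if
`HasEulerChar X` holds. -/
noncomputable def eulerCharacteristic (X : Type) [TopologicalSpace X] : ℤ :=
  ∑ᶠ n : ℕ, (-1) ^ n * (Module.finrank ℤ (singularH X n) : ℤ)

/-! The fibres of a span partition its apex, so `EEven S` and `EOdd S` are the sets of nondegenerate
simplices of even and of odd dimension. By homotopy invariance the claim becomes `χ(|S|) = ∑ (-1)^k
|S_k°|` for a finite simplicial set.

Simplicial and singular homology are never compared. The proof is a double induction, on the
dimension and on the number of nondegenerate simplices of top dimension `d`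
(`SSet.hasEulerData_toTop`). The simplices without a chosen top simplex `x` as a face form a
subcomplex `A`, and `|S|` is `|A|` with a `d`-cell attached (`cellAttachment`). Cover `|S|` by a
neighbourhood that deformation retracts to `|A|` and by the open cell, which is contractible. Their
intersection is an open collar `C` of the boundary of the simplex, and Mayer-Vietoris gives `χ(|S|)
= χ(|A|) + 1 - χ(C)`.

The same formula for `∂Δ^d ⊆ Δ^d` reads `1 = χ(∂Δ^d) + 1 - χ(C)`. Hence `χ(C) = χ(∂Δ^d)`, which is
`1 - (-1)^d` by the induction hypothesis and the alternating sum of binomial coefficients. Each top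
simplex therefore contributes `(-1)^d`, and the homology of spheres is not needed.

Mayer-Vietoris rests on two facts. Free chains turn the union of two subcomplexes into a short exact
sequence (`freeChains_shortExact`). Singular chains subordinate to an open cover compute singular
homology (`quasiIso_smallChains`, by barycentric subdivision). Finite generation and vanishing in
large degrees are carried along in `EulerData`. -/

section

open CategoryTheory Limits

/-! ### Ranks in long exact sequences and Euler characteristics of complexes. -/

section Rank

variable {R : Type*} [CommRing R] {A B C : Type*} [AddCommGroup A] [AddCommGroup B]
  [AddCommGroup C] [Module R A] [Module R B] [Module R C]

lemma Function.Exact.finrank_eq_add [IsDomain R] [Module.Finite R B] {f : A →ₗ[R] B}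
    {g : B →ₗ[R] C} (h : Function.Exact f g) :
    Module.finrank R B = Module.finrank R f.range + Module.finrank R g.range := by
  have := Submodule.finrank_quotient_add_finrank (LinearMap.ker g)
  rw [g.quotKerEquivRange.finrank_eq, LinearMap.exact_iff.1 h] at this
  omega

lemma Function.Exact.finite_middle [IsNoetherianRing R] [Module.Finite R A] [Module.Finite R C]
    {f : A →ₗ[R] B} {g : B →ₗ[R] C} (h : Function.Exact f g) : Module.Finite R B := by
  have h1 : Module.Finite R (LinearMap.ker g) := by
    rw [LinearMap.exact_iff.1 h]; infer_instance
  have h2 : Module.Finite R (B ⧸ LinearMap.ker g) := Module.Finite.equiv g.quotKerEquivRange.symm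
  exact Module.Finite.of_submodule_quotient (LinearMap.ker g)

lemma finrank_prod_eq_add [IsDomain R] [Module.Finite R A] [Module.Finite R B] :
    Module.finrank R (A × B) = Module.finrank R A + Module.finrank R B := by
  have := Submodule.finrank_quotient_add_finrank (LinearMap.ker (LinearMap.fst R A B))
  rw [((LinearMap.fst R A B).quotKerEquivOfSurjective
    LinearMap.fst_surjective).finrank_eq, LinearMap.ker_fst,
    LinearMap.finrank_range_of_inj LinearMap.inr_injective] at this
  exact this.symm

end Rank

/-- The homology of the complex `K` is finitely generated, vanishes in large degrees, and its ranks
have alternating sum `e`. -/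
def EulerData {R : Type} [CommRing R] (K : ChainComplex (ModuleCat.{0} R) ℕ) (e : ℤ) : Prop :=
  (∀ n, Module.Finite R (K.homology n)) ∧
    ∃ N, (∀ n, N ≤ n → Subsingleton (K.homology n)) ∧
      ∑ n ∈ Finset.range N, (-1) ^ n * (Module.finrank R (K.homology n) : ℤ) = e

lemma sum_range_eq_of_eventually_zero {f : ℕ → ℤ} {N M : ℕ} (h : ∀ n, N ≤ n → f n = 0)
    (hNM : N ≤ M) : ∑ n ∈ Finset.range M, f n = ∑ n ∈ Finset.range N, f n := by
  symm
  apply Finset.sum_subset (Finset.range_mono hNM)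
  intro n _ hn
  exact h n (by simpa using hn)

namespace EulerData

variable {R : Type} [CommRing R] [IsDomain R] {K L : ChainComplex (ModuleCat.{0} R) ℕ} {e e' : ℤ}

/-- The bound may be raised at will, so several complexes can be summed over a common range. -/
lemma exists_sum_range (h : EulerData K e) :
    ∃ N, ∀ M, N ≤ M → (Subsingleton (K.homology M)) ∧
      ∑ n ∈ Finset.range M, (-1) ^ n * (Module.finrank R (K.homology n) : ℤ) = e := by
  obtain ⟨-, N, h0, hs⟩ := h
  refine ⟨N, fun M hM => ⟨h0 M hM, ?_⟩⟩
  rw [← hs]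
  refine sum_range_eq_of_eventually_zero (fun n hn => ?_) hM
  have := h0 n hn
  simp [Module.finrank_zero_of_subsingleton]

omit [IsDomain R] in
lemma of_linearEquiv (φ : ∀ n, K.homology n ≃ₗ[R] L.homology n) (h : EulerData K e) :
    EulerData L e := by
  obtain ⟨hf, N, h0, hs⟩ := h
  refine ⟨fun n => Module.Finite.equiv (φ n), N, fun n hn => ?_, ?_⟩
  · have := h0 n hn
    exact (φ n).symm.toEquiv.subsingleton
  · rw [← hs]
    exact Finset.sum_congr rfl fun n _ => by rw [(φ n).finrank_eq]

omit [IsDomain R] in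
lemma of_quasiIso (f : K ⟶ L) [QuasiIso f] (h : EulerData K e) : EulerData L e :=
  h.of_linearEquiv fun n => (asIso (HomologicalComplex.homologyMap f n)).toLinearEquiv

omit [IsDomain R] in
lemma of_quasiIso' (f : K ⟶ L) [QuasiIso f] (h : EulerData L e) : EulerData K e :=
  h.of_linearEquiv fun n => (asIso (HomologicalComplex.homologyMap f n)).symm.toLinearEquiv

lemma biprod (h : EulerData K e) (h' : EulerData L e') : EulerData (K ⊞ L) (e + e') := by
  have (n : ℕ) : PreservesBinaryBiproduct K L
      (HomologicalComplex.homologyFunctor (ModuleCat R) (ComplexShape.down ℕ) n) :=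
    preservesBinaryBiproduct_of_preservesBiproduct _ _ _
  let φ (n : ℕ) : (K ⊞ L).homology n ≃ₗ[R] K.homology n × L.homology n :=
    ((HomologicalComplex.homologyFunctor (ModuleCat.{0} R) _ n).mapBiprod K L ≪≫
      ModuleCat.biprodIsoProd _ _).toLinearEquiv
  obtain ⟨N, hN⟩ := h.exists_sum_range
  obtain ⟨N', hN'⟩ := h'.exists_sum_range
  have hf := h.1
  have hf' := h'.1
  refine ⟨fun n => Module.Finite.equiv (φ n).symm, max N N', fun n hn => ?_, ?_⟩
  · have := (hN n ((le_max_left _ _).trans hn)).1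
    have := (hN' n ((le_max_right _ _).trans hn)).1
    exact (φ n).toEquiv.subsingleton
  · rw [← (hN _ (le_max_left N N')).2, ← (hN' _ (le_max_right N N')).2, ← Finset.sum_add_distrib]
    refine Finset.sum_congr rfl fun n _ => ?_
    rw [(φ n).finrank_eq, finrank_prod_eq_add]
    push_cast
    ring

omit [IsDomain R] in
lemma subsingleton_of_exact {A B C : ModuleCat.{0} R} {f : A ⟶ B} {g : B ⟶ C} {w : f ≫ g = 0}
    (h : (ShortComplex.mk f g w).Exact) [Subsingleton A] [Subsingleton C] : Subsingleton B := by
  have hex := (ShortComplex.ShortExact.moduleCat_exact_iff_function_exact _).1 h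
  refine subsingleton_of_forall_eq 0 fun b => ?_
  obtain ⟨a, ha⟩ := (hex b).1 (Subsingleton.elim _ _)
  rw [← ha, Subsingleton.elim a 0]
  exact map_zero f.hom

section LongExact

variable {S : ShortComplex (ChainComplex (ModuleCat.{0} R) ℕ)} (hS : S.ShortExact)

include hS

/-- `r (n + 1)` is the rank of the connecting map from degree `n + 1` of `X₃` to degree `n` of `X₁`.
Each homology rank is the sum of the ranks of its incoming and outgoing maps, and those of `f` and
`g` cancel. `r 0 = 0` because the map induced by `g` in degree `0` is onto. -/
lemma exact_terms
    (h1 : ∀ n, Module.Finite R (S.X₁.homology n)) (h2 : ∀ n, Module.Finite R (S.X₂.homology n))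
    (h3 : ∀ n, Module.Finite R (S.X₃.homology n)) :
    ∃ r : ℕ → ℕ, r 0 = 0 ∧ (∀ n, Subsingleton (S.X₁.homology n) → r (n + 1) = 0) ∧
      ∀ n, (Module.finrank R (S.X₁.homology n) : ℤ) + Module.finrank R (S.X₃.homology n) =
        Module.finrank R (S.X₂.homology n) + r (n + 1) + r n := by
  have rel (n : ℕ) : (ComplexShape.down ℕ).Rel (n + 1) n := rfl
  let δ (n : ℕ) := hS.δ (n + 1) n (rel n)
  let r : ℕ → ℕ := fun n => match n with
    | 0 => 0
    | n + 1 => Module.finrank R (δ n).hom.range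
  refine ⟨r, rfl, fun n hn => Module.finrank_zero_of_subsingleton, fun n => ?_⟩
  have e1 := ((ShortComplex.ShortExact.moduleCat_exact_iff_function_exact _).1
    (hS.homology_exact₁ (n + 1) n (rel n)))
  have e2 := ((ShortComplex.ShortExact.moduleCat_exact_iff_function_exact _).1
    (hS.homology_exact₂ n))
  have f1 : Module.finrank R (S.X₁.homology n) = r (n + 1) + _ :=
    Function.Exact.finrank_eq_add (R := R) (f := (δ n).hom)
    (g := (HomologicalComplex.homologyMap S.f n).hom) e1
  have f2 := Function.Exact.finrank_eq_add (R := R)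
    (f := (HomologicalComplex.homologyMap S.f n).hom)
    (g := (HomologicalComplex.homologyMap S.g n).hom) e2
  have f3 : Module.finrank R (S.X₃.homology n) =
      Module.finrank R (HomologicalComplex.homologyMap S.g n).hom.range + r n := by
    clear e1 e2 f1 f2
    cases n with
    | zero =>
      have := hS.epi_g
      have : Epi (HomologicalComplex.homologyMap S.g 0) :=
        HomologicalComplex.epi_homologyMap_of_epi_of_not_rel _ _ (by simp)
      rw [LinearMap.range_eq_top.2 ((ModuleCat.epi_iff_surjective _).1 this), finrank_top]
      rfl
    | succ n =>
      have e3 := ((ShortComplex.ShortExact.moduleCat_exact_iff_function_exact _).1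
        (hS.homology_exact₃ (n + 1) n (rel n)))
      exact Function.Exact.finrank_eq_add (R := R)
        (f := (HomologicalComplex.homologyMap S.g (n + 1)).hom) (g := (δ n).hom) e3
  rw [f1, f2, f3]
  push_cast
  ring

/-- The connecting ranks telescope to a single term `r M`. It belongs to the map into degree `M - 1`
of `X₁`, which is why `N < M` has to be strict. -/
lemma alternating_sum_eq
    (h1 : ∀ n, Module.Finite R (S.X₁.homology n)) (h2 : ∀ n, Module.Finite R (S.X₂.homology n))
    (h3 : ∀ n, Module.Finite R (S.X₃.homology n)) {N : ℕ}
    (hN : ∀ n, N ≤ n → Subsingleton (S.X₁.homology n)) {M : ℕ} (hM : N < M) :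
    ∑ n ∈ Finset.range M, (-1 : ℤ) ^ n * (Module.finrank R (S.X₁.homology n) : ℤ) +
      ∑ n ∈ Finset.range M, (-1 : ℤ) ^ n * (Module.finrank R (S.X₃.homology n) : ℤ) =
    ∑ n ∈ Finset.range M, (-1 : ℤ) ^ n * (Module.finrank R (S.X₂.homology n) : ℤ) := by
  obtain ⟨r, r0, rN, hr⟩ := exact_terms hS h1 h2 h3
  have key : ∀ m, ∑ n ∈ Finset.range m, (-1 : ℤ) ^ n * (Module.finrank R (S.X₁.homology n) : ℤ) +
      ∑ n ∈ Finset.range m, (-1 : ℤ) ^ n * (Module.finrank R (S.X₃.homology n) : ℤ) =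
    ∑ n ∈ Finset.range m, (-1 : ℤ) ^ n * (Module.finrank R (S.X₂.homology n) : ℤ) -
      (-1 : ℤ) ^ m * r m := by
    intro m
    induction m with
    | zero => simp [r0]
    | succ m ih =>
      simp only [Finset.sum_range_succ]
      have := hr m
      rw [pow_succ]
      linear_combination ih + (-1 : ℤ) ^ m * this
  rw [key, show r M = 0 from ?_]
  · simp
  · obtain ⟨m, rfl⟩ : ∃ m, M = m + 1 := ⟨M - 1, by omega⟩
    exact rN m (hN m (by omega))

omit [IsDomain R] in
lemma finite_X₃ [IsNoetherianRing R] (h1 : ∀ n, Module.Finite R (S.X₁.homology n))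
    (h2 : ∀ n, Module.Finite R (S.X₂.homology n)) (n : ℕ) :
    Module.Finite R (S.X₃.homology n) := by
  cases n with
  | zero =>
    have := hS.epi_g
    have : Epi (HomologicalComplex.homologyMap S.g 0) :=
      HomologicalComplex.epi_homologyMap_of_epi_of_not_rel _ _ (by simp)
    exact Module.Finite.of_surjective (HomologicalComplex.homologyMap S.g 0).hom
      ((ModuleCat.epi_iff_surjective _).1 this)
  | succ n =>
    have e3 := ((ShortComplex.ShortExact.moduleCat_exact_iff_function_exact _).1
        (hS.homology_exact₃ (n + 1) n rfl))
    exact Function.Exact.finite_middle (R := R)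
      (f := (HomologicalComplex.homologyMap S.g (n + 1)).hom)
      (g := (hS.δ (n + 1) n rfl).hom) e3

omit [IsDomain R] in
lemma finite_X₁ [IsNoetherianRing R] (h2 : ∀ n, Module.Finite R (S.X₂.homology n))
    (h3 : ∀ n, Module.Finite R (S.X₃.homology n)) (n : ℕ) :
    Module.Finite R (S.X₁.homology n) := by
  have e1 := ((ShortComplex.ShortExact.moduleCat_exact_iff_function_exact _).1
    (hS.homology_exact₁ (n + 1) n rfl))
  exact Function.Exact.finite_middle (R := R) (f := (hS.δ (n + 1) n rfl).hom)
    (g := (HomologicalComplex.homologyMap S.f n).hom) e1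

variable [IsNoetherianRing R]

lemma of_shortExact₃ (h1 : EulerData S.X₁ e) (h2 : EulerData S.X₂ e') :
    EulerData S.X₃ (e' - e) := by
  obtain ⟨N, hN⟩ := h1.exists_sum_range
  obtain ⟨N', hN'⟩ := h2.exists_sum_range
  have f3 := finite_X₃ hS h1.1 h2.1
  -- The shift by one: degree `n` of `X₃` sits between degree `n` of `X₂` and degree `n - 1` of
  -- `X₁`.
  refine ⟨f3, max N N' + 1, fun n hn => ?_, ?_⟩
  · obtain ⟨m, rfl⟩ : ∃ m, n = m + 1 := ⟨n - 1, by omega⟩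
    have := (hN m (by omega)).1
    have := (hN' (m + 1) (by omega)).1
    exact subsingleton_of_exact (hS.homology_exact₃ (m + 1) m rfl)
  · have := alternating_sum_eq hS h1.1 h2.1 f3 (fun n hn => (hN n hn).1)
      (show N < max N N' + 1 by omega)
    rw [(hN _ (by omega)).2, (hN' _ (by omega)).2] at this
    linarith

lemma of_shortExact₁ (h2 : EulerData S.X₂ e) (h3 : EulerData S.X₃ e') :
    EulerData S.X₁ (e - e') := by
  obtain ⟨N, hN⟩ := h2.exists_sum_range
  obtain ⟨N', hN'⟩ := h3.exists_sum_range
  have f1 := finite_X₁ hS h2.1 h3.1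
  have h0 (n : ℕ) (hn : max N N' ≤ n) : Subsingleton (S.X₁.homology n) := by
    have := (hN n (by omega)).1
    have := (hN' (n + 1) (by omega)).1
    exact subsingleton_of_exact (hS.homology_exact₁ (n + 1) n rfl)
  refine ⟨f1, max N N' + 1, fun n hn => h0 n (by omega), ?_⟩
  have := alternating_sum_eq hS f1 h2.1 h3.1 h0 (Nat.lt_succ_self _)
  rw [(hN _ (by omega)).2, (hN' _ (by omega)).2] at this
  linarith

end LongExact

end EulerData

end

/-! ### Free chains of simplicial sets and the Mayer-Vietoris sequence of subcomplexes. -/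

section

open CategoryTheory Limits

section ElementwiseHomology

variable {R : Type} [CommRing R]

namespace HomologicalComplex

variable {ι : Type*} {c : ComplexShape ι} (K : HomologicalComplex (ModuleCat.{0} R) c)

lemma exists_cycles_of_d_eq_zero {i j : ι} (hj : c.next i = j) (x : K.X i)
    (hx : K.d i j x = 0) : ∃ z : K.cycles i, K.iCycles i z = x := by
  refine ⟨K.liftCycles (ModuleCat.ofHom (LinearMap.toSpanSingleton R _ x)) j hj ?_ (1 : R), ?_⟩
  · ext
    simpa using hx
  · rw [← ConcreteCategory.comp_apply, liftCycles_i]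
    simp

lemma exists_toCycles_of_homologyπ_eq_zero {i j : ι} (hi : c.prev j = i) (z : K.cycles j)
    (hz : K.homologyπ j z = 0) : ∃ w : K.X i, K.toCycles i j w = z := by
  have hex := ShortComplex.exact_of_g_is_cokernel (ShortComplex.mk (K.toCycles i j)
    (K.homologyπ j) (by simp)) (K.homologyIsCokernel i j hi)
  exact (ShortComplex.moduleCat_exact_iff _).1 hex z hz

lemma homologyπ_surjective (i : ι) : Function.Surjective (K.homologyπ i) :=
  (ModuleCat.epi_iff_surjective _).1 inferInstance

lemma iCycles_injective (i : ι) : Function.Injective (K.iCycles i) :=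
  (ModuleCat.mono_iff_injective _).1 inferInstance

/-- A degreewise injective morphism whose relative cycles are relative boundaries is a
quasi-isomorphism. -/
lemma quasiIso_of_injective {K L : ChainComplex (ModuleCat.{0} R) ℕ} (f : K ⟶ L)
    (hf : ∀ n, Function.Injective (f.f n))
    (h : ∀ n (z : L.X n),
      (∃ y, f.f ((ComplexShape.down ℕ).next n) y = L.d n ((ComplexShape.down ℕ).next n) z) →
      ∃ (w : L.X (n + 1)) (x : K.X n), f.f n x = z - L.d (n + 1) n w) : QuasiIso f := by
  have comm {i j : ℕ} (x : K.X i) : f.f j (K.d i j x) = L.d i j (f.f i x) := by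
    rw [← ConcreteCategory.comp_apply, ← ConcreteCategory.comp_apply, f.comm]
  have dd {C : ChainComplex (ModuleCat.{0} R) ℕ} {i j k : ℕ} (x : C.X i) :
      C.d j k (C.d i j x) = 0 := by
    rw [← ConcreteCategory.comp_apply, C.d_comp_d]; rfl
  have iC {C : ChainComplex (ModuleCat.{0} R) ℕ} {i j : ℕ} (z : C.cycles i) :
      C.d i j (C.iCycles i z) = 0 := by
    rw [← ConcreteCategory.comp_apply, C.iCycles_d]; rfl
  have tC {C : ChainComplex (ModuleCat.{0} R) ℕ} {i j : ℕ} (z : C.X i) :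
      C.iCycles j (C.toCycles i j z) = C.d i j z := by
    rw [← ConcreteCategory.comp_apply, C.toCycles_i]
  have tπ {C : ChainComplex (ModuleCat.{0} R) ℕ} {i j : ℕ} (z : C.X i) :
      C.homologyπ j (C.toCycles i j z) = 0 := by
    rw [← ConcreteCategory.comp_apply, C.toCycles_comp_homologyπ]; rfl
  have cm {n : ℕ} (z : K.cycles n) :
      L.iCycles n (HomologicalComplex.cyclesMap f n z) = f.f n (K.iCycles n z) := by
    rw [← ConcreteCategory.comp_apply, ← ConcreteCategory.comp_apply,
      HomologicalComplex.cyclesMap_i]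
  have cπ {n : ℕ} (z : K.cycles n) : HomologicalComplex.homologyMap f n (K.homologyπ n z) =
      L.homologyπ n (HomologicalComplex.cyclesMap f n z) := by
    rw [← ConcreteCategory.comp_apply, ← ConcreteCategory.comp_apply,
      HomologicalComplex.homologyπ_naturality]
  refine ⟨fun n => ?_⟩
  rw [quasiIsoAt_iff_isIso_homologyMap, ConcreteCategory.isIso_iff_bijective]
  constructor
  · rw [injective_iff_map_eq_zero]
    intro a ha
    obtain ⟨z, rfl⟩ := K.homologyπ_surjective n a
    rw [cπ] at ha
    obtain ⟨w, hw⟩ := L.exists_toCycles_of_homologyπ_eq_zero (ChainComplex.prev ℕ n) _ ha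
    have hw' : L.d (n + 1) n w = f.f n (K.iCycles n z) := by rw [← tC, hw, cm]
    -- The chain `w` bounds the image of a cycle of `K`, so it is a relative cycle. Subtracting a
    -- boundary moves it into the image of `K` without changing its differential.
    obtain ⟨w', y, hy⟩ := h (n + 1) w
      (by rw [ChainComplex.next_nat_succ]; exact ⟨K.iCycles n z, hw'.symm⟩)
    have : K.toCycles (n + 1) n y = z := by
      apply K.iCycles_injective
      apply hf
      rw [tC, comm, hy, map_sub, dd, sub_zero, hw']
    rw [← this, tπ]
  · intro b
    obtain ⟨z, rfl⟩ := L.homologyπ_surjective n b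
    -- An absolute cycle is in particular a relative cycle.
    obtain ⟨w, x, hx⟩ := h n (L.iCycles n z) ⟨0, by rw [iC, map_zero]⟩
    have hdx : K.d n ((ComplexShape.down ℕ).next n) x = 0 := by
      apply hf
      rw [comm, hx, map_sub, iC, dd, map_zero, sub_zero]
    obtain ⟨z', hz'⟩ := K.exists_cycles_of_d_eq_zero rfl x hdx
    refine ⟨K.homologyπ n z', ?_⟩
    have : HomologicalComplex.cyclesMap f n z' = z - L.toCycles (n + 1) n w := by
      apply L.iCycles_injective
      rw [cm, hz', hx, map_sub, tC]
    rw [cπ, this, map_sub, tπ, sub_zero]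

end HomologicalComplex

end ElementwiseHomology

section FreeChains

variable (R : Type) [CommRing R]

/-- The complex of chains of a simplicial set, with chains given by finitely supported functions. -/
noncomputable def freeChains : SSet.{0} ⥤ ChainComplex (ModuleCat.{0} R) ℕ :=
  (SimplicialObject.whiskering _ _).obj (ModuleCat.free R) ⋙
    AlgebraicTopology.alternatingFaceMapComplex _

/-- The free module functor as a functor of coproducts of copies of the base ring. -/
noncomputable def sigmaConstIsoFree :
    sigmaConst.obj (ModuleCat.of R R) ≅ ModuleCat.free R :=
  -- Both functors are left adjoint to the forgetful functor, since linear maps `R → M` are elements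
  -- of `M`.
  (sigmaConstAdj _).leftAdjointUniq
    ((ModuleCat.adj R).ofNatIsoRight (NatIso.ofComponents (fun M =>
      Equiv.toIso (X := M) (Y := ModuleCat.of R R ⟶ M)
        ((LinearMap.ringLmapEquivSelf R R M).symm.toEquiv.trans
          (ModuleCat.homEquiv (M := ModuleCat.of R R) (N := M)).symm)) (by
        intro M N f
        ext x
        refine ModuleCat.hom_ext (LinearMap.ext_ring ?_)
        simp [LinearMap.ringLmapEquivSelf, ModuleCat.homEquiv])))

/-- The chain complex of a simplicial set, as a complex of finitely supported functions. -/
noncomputable def chainComplexIsoFreeChains :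
    (SSet.chainComplexFunctor (ModuleCat.{0} R)).obj (ModuleCat.of R R) ≅ freeChains R :=
  Functor.isoWhiskerRight ((SimplicialObject.whiskering _ _).mapIso (sigmaConstIsoFree R))
    (AlgebraicTopology.alternatingFaceMapComplex _)

/-- Colimits are computed degreewise on both sides, and in each degree the free module functor is a
left adjoint. -/
instance : PreservesColimitsOfShape WalkingSpan (freeChains R) :=
  HomologicalComplex.preservesColimitsOfShape_of_eval _ fun n => by
    change PreservesColimitsOfShape WalkingSpan
      ((evaluation _ _).obj (Opposite.op (SimplexCategory.mk n)) ⋙ ModuleCat.free R)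
    have := (ModuleCat.adj R).leftAdjoint_preservesColimits
    infer_instance

variable {R}

lemma freeChains_map_f_injective {X Y : SSet.{0}} (f : X ⟶ Y) [Mono f] (n : ℕ) :
    Function.Injective (((freeChains R).map f).f n) := by
  have : Function.Injective (f.app (Opposite.op (SimplexCategory.mk n))) :=
    (mono_iff_injective _).1 inferInstance
  exact Finsupp.mapDomain_injective this

instance {X Y : SSet.{0}} (f : X ⟶ Y) [Mono f] : Mono ((freeChains R).map f) :=
  HomologicalComplex.mono_of_mono_f _ fun n =>
    (ModuleCat.mono_iff_injective _).2 (freeChains_map_f_injective f n)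

variable {X : SSet.{0}} {A B : X.Subcomplex}

lemma SSet.Subcomplex.bicartSq_inf_sup (A B : X.Subcomplex) :
    SSet.Subcomplex.BicartSq (A ⊓ B) A B (A ⊔ B) := ⟨rfl, rfl⟩

lemma freeChains_isPushout (A B : X.Subcomplex) : IsPushout
    ((freeChains R).map (SSet.Subcomplex.homOfLE (inf_le_left : A ⊓ B ≤ A)))
    ((freeChains R).map (SSet.Subcomplex.homOfLE (inf_le_right : A ⊓ B ≤ B)))
    ((freeChains R).map (SSet.Subcomplex.homOfLE (le_sup_left : A ≤ A ⊔ B)))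
    ((freeChains R).map (SSet.Subcomplex.homOfLE (le_sup_right : B ≤ A ⊔ B))) :=
  (SSet.Subcomplex.bicartSq_inf_sup A B).isPushout.map (freeChains R)

-- A pushout square yields a right exact sequence; exactness on the left comes from the inclusion of
-- `A ⊓ B` into `A`, which is injective on chains.
variable (R) in
lemma freeChains_shortExact (A B : X.Subcomplex) :
    (freeChains_isPushout (R := R) A B).shortComplex.ShortExact where
  exact := (freeChains_isPushout A B).exact_shortComplex
  mono_f := by
    have h : (freeChains_isPushout (R := R) A B).shortComplex.f ≫ biprod.fst =
      (freeChains R).map (SSet.Subcomplex.homOfLE (inf_le_left : A ⊓ B ≤ A)) := biprod.lift_fst _ _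
    have : Mono (SSet.Subcomplex.homOfLE (inf_le_left : A ⊓ B ≤ A)) := inferInstance
    have : Mono ((freeChains R).map (SSet.Subcomplex.homOfLE (inf_le_left : A ⊓ B ≤ A))) :=
      inferInstance
    exact @mono_of_mono_fac _ _ _ _ _ _ _ _ this h
  epi_g := (freeChains_isPushout A B).epi_shortComplex_g

variable [IsDomain R] [IsNoetherianRing R]

lemma EulerData.freeChains_sup {a b c : ℤ} (ha : EulerData ((freeChains R).obj A) a)
    (hb : EulerData ((freeChains R).obj B) b)
    (hc : EulerData ((freeChains R).obj (A ⊓ B : X.Subcomplex)) c) :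
    EulerData ((freeChains R).obj (A ⊔ B : X.Subcomplex)) (a + b - c) :=
  EulerData.of_shortExact₃ (freeChains_shortExact R A B) hc (ha.biprod hb)

/-- The same sequence solved for the intersection. This direction evaluates the collar of a simplex.
-/
lemma EulerData.freeChains_inf {a b c : ℤ} (ha : EulerData ((freeChains R).obj A) a)
    (hb : EulerData ((freeChains R).obj B) b)
    (hc : EulerData ((freeChains R).obj (A ⊔ B : X.Subcomplex)) c) :
    EulerData ((freeChains R).obj (A ⊓ B : X.Subcomplex)) (a + b - c) :=
  EulerData.of_shortExact₁ (freeChains_shortExact R A B) (ha.biprod hb) hc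

end FreeChains

end

/-! ### Barycentric subdivision of chains of tuples. -/

section

open CategoryTheory Limits

section FaceChains

variable (R : Type) [CommRing R]

/-- The alternating sum of the faces, on finitely supported chains of a simplicial set. -/
noncomputable def faceSum (X : SSet.{0}) (n : ℕ) :
    (Simplices X (n + 1) →₀ R) →ₗ[R] (Simplices X n →₀ R) :=
  ∑ i : Fin (n + 2), (-1 : R) ^ (i : ℕ) • Finsupp.lmapDomain R R (X.δ i)

lemma freeChains_d_hom (X : SSet.{0}) (n : ℕ) :
    (((freeChains R).obj X).d (n + 1) n).hom = faceSum R X n := by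
  have : ((freeChains R).obj X).d (n + 1) n =
      ∑ i : Fin (n + 2), (-1 : ℤ) ^ (i : ℕ) • (ModuleCat.free R).map (X.δ i) :=
    AlgebraicTopology.alternatingFaceMapComplex_obj_d _ _
  refine (congrArg ModuleCat.Hom.hom this).trans ((ModuleCat.hom_sum _ _).trans ?_)
  refine Finset.sum_congr rfl fun i _ => ?_
  refine LinearMap.ext fun x => ?_
  obtain h | h := Nat.even_or_odd (i : ℕ)
  · rw [h.neg_one_pow, h.neg_one_pow, one_smul, one_smul]; rfl
  · rw [h.neg_one_pow, h.neg_one_pow]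
    exact (congrArg (fun f => ModuleCat.Hom.hom f x) (neg_one_smul ℤ
      ((ModuleCat.free R).map (X.δ i)))).trans
      (neg_one_smul R (Finsupp.lmapDomain R R (X.δ i) x)).symm

variable {R}

lemma faceSum_faceSum (X : SSet.{0}) (n : ℕ) (c : Simplices X (n + 2) →₀ R) :
    faceSum R X n (faceSum R X (n + 1) c) = 0 := by
  rw [← freeChains_d_hom, ← freeChains_d_hom]
  exact ConcreteCategory.congr_hom (((freeChains R).obj X).d_comp_d (n + 2) (n + 1) n) c

lemma mapDomain_faceSum {X Y : SSet.{0}} (f : X ⟶ Y) (n : ℕ) (c : Simplices X (n + 1) →₀ R) :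
    (faceSum R X n c).mapDomain (f.app (.op (.mk n))) =
      faceSum R Y n (c.mapDomain (f.app (.op (.mk (n + 1))))) := by
  rw [← freeChains_d_hom, ← freeChains_d_hom]
  exact (ConcreteCategory.congr_hom (((freeChains R).map f).comm (n + 1) n) c).symm

end FaceChains

section Codiscrete

/-- The simplicial set whose simplices are arbitrary tuples of elements of `V`. -/
def tuples (V : Type) : SSet.{0} where
  obj n := Fin (n.unop.len + 1) → V
  map f := ↾fun v => v ∘ f.unop.toOrderHom

/-- Composition with a map, as a morphism between simplicial sets of tuples. -/
def tuplesMap {V W : Type} (f : V → W) : tuples V ⟶ tuples W where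
  app n := ↾fun v => f ∘ v

variable {R : Type} [CommRing R] {V W : Type}

/-- The alternating sum of the faces of chains of tuples. -/
noncomputable def tupleBoundary (k : ℕ) :
    ((Fin (k + 2) → V) →₀ R) →ₗ[R] ((Fin (k + 1) → V) →₀ R) :=
  ∑ i : Fin (k + 2), (-1 : R) ^ (i : ℕ) • Finsupp.lmapDomain R R fun v => v ∘ i.succAbove

/-- Chains of tuples are the free chains of the simplicial set `tuples V`, so this is the identity
`d² = 0` there and needs no computation with indices. -/
lemma tupleBoundary_tupleBoundary (k : ℕ) (c : (Fin (k + 3) → V) →₀ R) :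
    tupleBoundary k (tupleBoundary (k + 1) c) = 0 :=
  faceSum_faceSum (tuples V) k c

lemma tupleBoundary_single (k : ℕ) (v : Fin (k + 2) → V) (a : R) :
    tupleBoundary k (Finsupp.single v a) =
      ∑ i : Fin (k + 2), (-1 : R) ^ (i : ℕ) • Finsupp.single (v ∘ i.succAbove) a := by
  simp [tupleBoundary, LinearMap.sum_apply]

lemma mapDomain_tupleBoundary (f : V → W) (k : ℕ) (c : (Fin (k + 2) → V) →₀ R) :
    (tupleBoundary k c).mapDomain (fun v => f ∘ v) =
      tupleBoundary k (c.mapDomain fun v => f ∘ v) :=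
  mapDomain_faceSum (tuplesMap f) k c

/-- The cone with apex `b` on a chain of tuples. -/
noncomputable def cone (b : V) (k : ℕ) :
    ((Fin (k + 1) → V) →₀ R) →ₗ[R] ((Fin (k + 2) → V) →₀ R) :=
  Finsupp.lmapDomain R R fun v : Fin (k + 1) → V => (Fin.cons b v : Fin (k + 2) → V)

lemma cone_single (b : V) (k : ℕ) (v : Fin (k + 1) → V) (a : R) :
    cone b k (Finsupp.single v a) = Finsupp.single (Fin.cons b v : Fin (k + 2) → V) a :=
  Finsupp.mapDomain_single

/-- Face `0` of a cone drops the apex, and face `i + 1` is the cone on face `i`, with the opposite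
sign. -/
lemma tupleBoundary_cone_succ (b : V) (k : ℕ) (c : (Fin (k + 2) → V) →₀ R) :
    tupleBoundary (k + 1) (cone b (k + 1) c) =
      c - cone b k (tupleBoundary k c) := by
  induction c using Finsupp.induction_linear with
  | zero => simp
  | add c c' h h' => rw [map_add, map_add, h, h', map_add, map_add]; abel
  | single v a =>
    rw [cone_single, tupleBoundary_single, tupleBoundary_single, Fin.sum_univ_succ, map_sum,
      sub_eq_add_neg, ← Finset.sum_neg_distrib]
    congr 1
    · simp only [Fin.val_zero, pow_zero, one_smul]
      rfl
    · refine Finset.sum_congr rfl fun i _ => ?_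
      rw [map_smul, cone_single, ← neg_smul, Fin.val_succ, pow_succ, mul_neg_one]
      congr 2
      funext j
      cases j using Fin.cases with
      | zero => simp
      | succ j => simp

/-- For a `0`-simplex `v` the boundary of the cone is `v - b`. The extra `b` cancels only on chains
of augmentation zero, such as boundaries. -/
lemma tupleBoundary_cone_zero (b : V) (c : (Fin 2 → V) →₀ R) :
    tupleBoundary 0 (cone b 0 (tupleBoundary 0 c)) = tupleBoundary 0 c := by
  have key (v : Fin 1 → V) (a : R) : tupleBoundary 0 (cone b 0 (Finsupp.single v a)) =
      Finsupp.single v a - Finsupp.single (fun _ => b) a := by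
    rw [cone_single, tupleBoundary_single, Fin.sum_univ_two]
    simp only [Fin.val_zero, pow_zero, one_smul, Fin.val_one, pow_one, neg_smul,
      ← sub_eq_add_neg]
    congr 2
    funext j
    fin_cases j
    rfl
  induction c using Finsupp.induction_linear with
  | zero => simp
  | add c c' h h' => simp only [map_add, h, h']
  | single v a =>
    rw [tupleBoundary_single, Fin.sum_univ_two]
    simp only [map_add, map_smul, key]
    simp only [Fin.val_zero, pow_zero, one_smul, Fin.val_one, pow_one, neg_smul]
    abel

variable (β : ∀ k, (Fin (k + 1) → V) → V)

/-- The barycentric subdivision of chains of tuples, with respect to a choice `β` of a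
barycenter of each tuple. -/
noncomputable def subdiv : ∀ k, ((Fin (k + 1) → V) →₀ R) →ₗ[R] ((Fin (k + 1) → V) →₀ R)
  | 0 => LinearMap.id
  | k + 1 => Finsupp.linearCombination R fun v =>
      cone (β (k + 1) v) k (subdiv k (tupleBoundary k (Finsupp.single v 1)))

/-- The homotopy between barycentric subdivision and the identity. -/
noncomputable def subdivHomotopy :
    ∀ k, ((Fin (k + 1) → V) →₀ R) →ₗ[R] ((Fin (k + 2) → V) →₀ R)
  | 0 => 0
  | k + 1 => Finsupp.linearCombination R fun v =>
      cone (β (k + 1) v) (k + 1) (Finsupp.single v 1 - subdiv β (k + 1) (Finsupp.single v 1) -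
        subdivHomotopy k (tupleBoundary k (Finsupp.single v 1)))

lemma subdiv_single (k : ℕ) (v : Fin (k + 2) → V) :
    subdiv (R := R) β (k + 1) (Finsupp.single v 1) =
      cone (β (k + 1) v) k (subdiv β k (tupleBoundary k (Finsupp.single v 1))) := by
  rw [subdiv, Finsupp.linearCombination_single, one_smul]

lemma subdivHomotopy_single (k : ℕ) (v : Fin (k + 2) → V) :
    subdivHomotopy (R := R) β (k + 1) (Finsupp.single v 1) =
      cone (β (k + 1) v) (k + 1) (Finsupp.single v 1 - subdiv β (k + 1) (Finsupp.single v 1) -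
        subdivHomotopy β k (tupleBoundary k (Finsupp.single v 1))) := by
  rw [subdivHomotopy, Finsupp.linearCombination_single, one_smul]

/-- Subdivision cones off the subdivided boundary. By induction that base is a cycle, so the
boundary of the cone is the base itself. -/
lemma tupleBoundary_subdiv (k : ℕ) (c : (Fin (k + 2) → V) →₀ R) :
    tupleBoundary k (subdiv β (k + 1) c) = subdiv β k (tupleBoundary k c) := by
  suffices h : tupleBoundary k ∘ₗ subdiv β (k + 1) = subdiv β k ∘ₗ tupleBoundary k from
    LinearMap.congr_fun h c
  clear c
  induction k with
  | zero =>
    refine Finsupp.lhom_ext' fun v => LinearMap.ext_ring ?_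
    simp only [LinearMap.comp_apply, Finsupp.lsingle_apply]
    rw [subdiv_single]
    exact tupleBoundary_cone_zero _ _
  | succ k ih =>
    refine Finsupp.lhom_ext' fun v => LinearMap.ext_ring ?_
    simp only [LinearMap.comp_apply, Finsupp.lsingle_apply]
    rw [subdiv_single, tupleBoundary_cone_succ]
    have := LinearMap.congr_fun ih (tupleBoundary (k + 1) (Finsupp.single v 1))
    simp only [LinearMap.comp_apply] at this
    rw [this, tupleBoundary_tupleBoundary, map_zero, map_zero, sub_zero]

/-- The chain under the cone in `subdivHomotopy` is a cycle by the identity one degree lower, so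
taking the boundary of the cone returns it. -/
lemma tupleBoundary_subdivHomotopy (k : ℕ) (c : (Fin (k + 2) → V) →₀ R) :
    tupleBoundary (k + 1) (subdivHomotopy β (k + 1) c) +
      subdivHomotopy β k (tupleBoundary k c) = c - subdiv β (k + 1) c := by
  suffices h : tupleBoundary (k + 1) ∘ₗ subdivHomotopy β (k + 1) +
      subdivHomotopy β k ∘ₗ tupleBoundary k = LinearMap.id - subdiv β (k + 1) from
    LinearMap.congr_fun h c
  clear c
  induction k with
  | zero =>
    refine Finsupp.lhom_ext' fun v => LinearMap.ext_ring ?_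
    simp only [LinearMap.comp_apply, Finsupp.lsingle_apply, LinearMap.add_apply,
      LinearMap.sub_apply, LinearMap.id_apply]
    rw [subdivHomotopy_single, tupleBoundary_cone_succ, map_sub (tupleBoundary (R := R) (V := V) 0),
      map_sub (tupleBoundary (R := R) (V := V) 0),
      tupleBoundary_subdiv]
    simp [subdiv, subdivHomotopy]
  | succ k ih =>
    refine Finsupp.lhom_ext' fun v => LinearMap.ext_ring ?_
    simp only [LinearMap.comp_apply, Finsupp.lsingle_apply, LinearMap.add_apply,
      LinearMap.sub_apply, LinearMap.id_apply]
    have := LinearMap.congr_fun ih (tupleBoundary (k + 1) (Finsupp.single v 1))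
    simp only [LinearMap.comp_apply, LinearMap.add_apply, LinearMap.sub_apply, LinearMap.id_apply,
      tupleBoundary_tupleBoundary, map_zero, add_zero] at this
    rw [subdivHomotopy_single, tupleBoundary_cone_succ,
      map_sub (tupleBoundary (R := R) (V := V) (k + 1)), map_sub (tupleBoundary (R := R) (V := V) (k + 1)),
      tupleBoundary_subdiv, this]
    simp

section Naturality

variable {β} {γ : ∀ k, (Fin (k + 1) → W) → W} {f : V → W}

lemma mapDomain_cone (b : V) (k : ℕ) (c : (Fin (k + 1) → V) →₀ R) :
    (cone b k c).mapDomain (fun v => f ∘ v) =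
      cone (f b) k (c.mapDomain (fun v => f ∘ v)) := by
  simp only [cone, Finsupp.lmapDomain_apply, ← Finsupp.mapDomain_comp]
  congr 1
  funext v
  simp only [Function.comp_apply]
  funext j
  cases j using Fin.cases <;> rfl

variable (hf : ∀ k v, f (β k v) = γ k (f ∘ v))
include hf

/-- To be applied with `f` an affine map, which preserves barycenters. -/
lemma mapDomain_subdiv (k : ℕ) (c : (Fin (k + 1) → V) →₀ R) :
    (subdiv β k c).mapDomain (fun v => f ∘ v) =
      subdiv γ k (c.mapDomain (fun v => f ∘ v)) := by
  suffices h : Finsupp.lmapDomain R R (fun v => f ∘ v) ∘ₗ subdiv β k =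
      subdiv γ k ∘ₗ Finsupp.lmapDomain R R (fun v => f ∘ v) from
    LinearMap.congr_fun h c
  clear c
  induction k with
  | zero => rfl
  | succ k ih =>
    refine Finsupp.lhom_ext' fun v => LinearMap.ext_ring ?_
    simp only [LinearMap.comp_apply, Finsupp.lsingle_apply, Finsupp.lmapDomain_apply]
    have := LinearMap.congr_fun ih (tupleBoundary k (Finsupp.single v 1))
    simp only [LinearMap.comp_apply, Finsupp.lmapDomain_apply] at this
    rw [subdiv_single, mapDomain_cone, this, mapDomain_tupleBoundary, Finsupp.mapDomain_single, hf]
    exact (subdiv_single γ k _).symm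

lemma mapDomain_subdivHomotopy (k : ℕ) (c : (Fin (k + 1) → V) →₀ R) :
    (subdivHomotopy β k c).mapDomain (fun v => f ∘ v) =
      subdivHomotopy γ k (c.mapDomain (fun v => f ∘ v)) := by
  suffices h : Finsupp.lmapDomain R R (fun v => f ∘ v) ∘ₗ
      subdivHomotopy β k =
      subdivHomotopy γ k ∘ₗ Finsupp.lmapDomain R R (fun v => f ∘ v) from
    LinearMap.congr_fun h c
  clear c
  induction k with
  | zero => simp [subdivHomotopy]
  | succ k ih =>
    refine Finsupp.lhom_ext' fun v => LinearMap.ext_ring ?_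
    simp only [LinearMap.comp_apply, Finsupp.lsingle_apply, Finsupp.lmapDomain_apply]
    have := LinearMap.congr_fun ih (tupleBoundary k (Finsupp.single v 1))
    simp only [LinearMap.comp_apply, Finsupp.lmapDomain_apply] at this
    rw [subdivHomotopy_single, mapDomain_cone, ← Finsupp.lmapDomain_apply R R,
      map_sub (Finsupp.lmapDomain R R _), map_sub (Finsupp.lmapDomain R R _)]
    simp only [Finsupp.lmapDomain_apply]
    rw [this, mapDomain_tupleBoundary, mapDomain_subdiv hf, Finsupp.mapDomain_single, hf]
    exact (subdivHomotopy_single γ k _).symm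

end Naturality

end Codiscrete

end

/-! ### Affine simplices and the mesh of a subdivision. -/

section

open CategoryTheory Limits

namespace stdSimplex

variable {ι κ μ : Type} [Fintype ι] [Fintype κ] [Fintype μ]

/-- The affine map of standard simplices with prescribed images of the vertices. -/
noncomputable def affine (v : κ → stdSimplex ℝ ι) : C(stdSimplex ℝ κ, stdSimplex ℝ ι) where
  toFun t := ⟨∑ j, t j • (v j : ι → ℝ), (convex_stdSimplex ℝ ι).sum_mem
    (fun j _ => zero_le t j) (sum_eq_one t) (fun j _ => (v j).2)⟩
  continuous_toFun := by
    refine Continuous.subtype_mk (continuous_finsetSum _ fun j _ => ?_) _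
    exact ((continuous_apply j).comp continuous_subtype_val).smul continuous_const

lemma affine_coe (v : κ → stdSimplex ℝ ι) (t : stdSimplex ℝ κ) :
    (affine v t : ι → ℝ) = ∑ j, t j • (v j : ι → ℝ) := rfl

lemma affine_coe_apply (v : κ → stdSimplex ℝ ι) (t : stdSimplex ℝ κ) (i : ι) :
    affine v t i = ∑ j, t j * v j i := by
  rw [affine_coe, Finset.sum_apply]
  rfl

lemma affine_map [DecidableEq κ] (v : κ → stdSimplex ℝ ι) (f : μ → κ) (t : stdSimplex ℝ μ) :
    affine v (map f t) = affine (v ∘ f) t := by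
  ext i
  rw [affine_coe_apply, affine_coe_apply]
  simp only [map_coe, FunOnFinite.linearMap_apply_apply]
  simp_rw [Finset.sum_mul]
  rw [← Finset.sum_fiberwise (s := Finset.univ) (g := f)]
  refine Finset.sum_congr rfl fun j _ => Finset.sum_congr rfl fun i' hi => ?_
  simp only [Finset.mem_filter, Finset.mem_univ, true_and] at hi
  rw [Function.comp_apply, hi]

lemma affine_affine (v : κ → stdSimplex ℝ ι) (w : μ → stdSimplex ℝ κ) (t : stdSimplex ℝ μ) :
    affine v (affine w t) = affine (fun j => affine v (w j)) t := by
  ext i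
  simp only [affine_coe_apply, Finset.sum_mul, Finset.mul_sum]
  rw [Finset.sum_comm]
  exact Finset.sum_congr rfl fun j _ => Finset.sum_congr rfl fun i' _ => by ring

lemma affine_vertex [DecidableEq κ] (v : κ → stdSimplex ℝ ι) (j : κ) :
    affine v (vertex j) = v j := by
  ext i
  simp [affine_coe_apply, Pi.single_apply]

lemma affine_vertices [DecidableEq ι] (t : stdSimplex ℝ ι) : affine vertex t = t := by
  ext i
  simp [affine_coe_apply, Pi.single_apply]

lemma dist_affine_le {v : κ → stdSimplex ℝ ι} {p : stdSimplex ℝ ι} {r : ℝ}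
    (h : ∀ j, dist (v j) p ≤ r) (t : stdSimplex ℝ κ) : dist (affine v t) p ≤ r :=
  (convex_closedBall (p : ι → ℝ) r).sum_mem (fun j _ => zero_le t j) (sum_eq_one t)
    (fun j _ => h j)

/-- The difference is the average of the vectors `v j - v i`. The term `i = j` vanishes, which
leaves `card κ - 1` terms out of `card κ`. -/
lemma dist_affine_barycenter_le [Nonempty κ] {v : κ → stdSimplex ℝ ι} {r : ℝ}
    (h : ∀ i j, dist (v i) (v j) ≤ r) (j : κ) :
    dist (v j) (affine v barycenter) ≤
      ((Fintype.card κ : ℝ) - 1) / (Fintype.card κ : ℝ) * r := by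
  classical
  have hc : (Fintype.card κ : ℝ) ≠ 0 := by exact_mod_cast Fintype.card_ne_zero
  have hc' : (0 : ℝ) < Fintype.card κ := by exact_mod_cast Fintype.card_pos
  have : (v j : ι → ℝ) - affine v barycenter =
      ∑ i, (Fintype.card κ : ℝ)⁻¹ • ((v j : ι → ℝ) - v i) := by
    rw [affine_coe]
    simp only [smul_sub, Finset.sum_sub_distrib, Finset.sum_const,
      Finset.card_univ]
    congr 1
    rw [← Nat.cast_smul_eq_nsmul ℝ, smul_smul, mul_inv_cancel₀ hc, one_smul]
  change dist (v j : ι → ℝ) (affine v barycenter : ι → ℝ) ≤ _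
  rw [dist_eq_norm, this]
  refine (norm_sum_le _ _).trans ?_
  rw [← Finset.add_sum_erase _ _ (Finset.mem_univ j)]
  simp only [sub_self, smul_zero, norm_zero, zero_add]
  refine (Finset.sum_le_card_nsmul _ _ ((Fintype.card κ : ℝ)⁻¹ * r) fun i _ => ?_).trans ?_
  · rw [norm_smul, Real.norm_of_nonneg (inv_nonneg.2 hc'.le), ← dist_eq_norm]
    exact mul_le_mul_of_nonneg_left (h j i) (inv_nonneg.2 hc'.le)
  · rw [Finset.card_erase_of_mem (Finset.mem_univ _), Finset.card_univ, nsmul_eq_mul,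
      Nat.cast_sub Fintype.card_pos, Nat.cast_one]
    exact le_of_eq (by ring)

end stdSimplex

/-- The barycenter of a tuple of points of a standard simplex. -/
noncomputable def tupleBarycenter {ι : Type} [Fintype ι] (k : ℕ)
    (v : Fin (k + 1) → stdSimplex ℝ ι) : stdSimplex ℝ ι :=
  stdSimplex.affine v stdSimplex.barycenter

lemma affine_tupleBarycenter {ι κ : Type} [Fintype ι] [Fintype κ] (v : κ → stdSimplex ℝ ι) (k : ℕ)
    (w : Fin (k + 1) → stdSimplex ℝ κ) :
    stdSimplex.affine v (tupleBarycenter k w) = tupleBarycenter k (stdSimplex.affine v ∘ w) :=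
  stdSimplex.affine_affine _ _ _

section Mesh

variable {R : Type} [CommRing R] {ι : Type} [Fintype ι]

lemma Finsupp.mapDomain_mem_supported {α γ : Type*} {s : Set α} {t : Set γ} {f : α → γ}
    (h : ∀ a ∈ s, f a ∈ t) {c : α →₀ R} (hc : c ∈ Finsupp.supported R R s) :
    c.mapDomain f ∈ Finsupp.supported R R t := by
  have := Submodule.mem_map_of_mem (f := Finsupp.lmapDomain R R f) hc
  rw [Finsupp.lmapDomain_supported] at this
  exact Finsupp.supported_mono (Set.image_subset_iff.2 h) this

lemma Finsupp.linearMap_mem_of_mem_supported {α M : Type*} [AddCommGroup M] [Module R M]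
    {s : Set α} {P : Submodule R M} (f : (α →₀ R) →ₗ[R] M)
    (h : ∀ a ∈ s, f (Finsupp.single a 1) ∈ P) {c : α →₀ R} (hc : c ∈ Finsupp.supported R R s) :
    f c ∈ P := by
  rw [Finsupp.supported_eq_span_single] at hc
  induction hc using Submodule.span_induction with
  | mem x hx => obtain ⟨a, ha, rfl⟩ := hx; exact h a ha
  | zero => rw [map_zero]; exact P.zero_mem
  | add x y _ _ hx hy => rw [map_add]; exact P.add_mem hx hy
  | smul r x _ hx => rw [map_smul]; exact P.smul_mem r hx

/-- Tuples of points with pairwise distances at most `r`. -/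
def meshLE (ι : Type) [Fintype ι] (k : ℕ) (r : ℝ) : Set (Fin (k + 1) → stdSimplex ℝ ι) :=
  {v | ∀ i j, dist (v i) (v j) ≤ r}

lemma tupleBoundary_single_mem {V : Type} (k : ℕ) {v : Fin (k + 2) → V}
    {s : Set (Fin (k + 1) → V)} (h : ∀ i : Fin (k + 2), v ∘ i.succAbove ∈ s) :
    tupleBoundary k (Finsupp.single v (1 : R)) ∈ Finsupp.supported R R s := by
  rw [tupleBoundary_single]
  exact Submodule.sum_mem _ fun i _ =>
    Submodule.smul_mem _ _ (Finsupp.single_mem_supported _ _ (h i))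

lemma cone_mem_supported {V : Type} {b : V} {k : ℕ} {s : Set (Fin (k + 1) → V)}
    {t : Set (Fin (k + 2) → V)} (h : ∀ v ∈ s, (Fin.cons b v : Fin (k + 2) → V) ∈ t)
    {c : (Fin (k + 1) → V) →₀ R} (hc : c ∈ Finsupp.supported R R s) :
    cone b k c ∈ Finsupp.supported R R t :=
  Finsupp.mapDomain_mem_supported h hc

lemma ratio_mono {k : ℕ} {r : ℝ} (hr : 0 ≤ r) :
    (k : ℝ) / (k + 1) * r ≤ ((k + 1 : ℕ) : ℝ) / ((k + 1 : ℕ) + 1) * r := by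
  refine mul_le_mul_of_nonneg_right ?_ hr
  rw [div_le_div_iff₀ (by positivity) (by positivity)]
  push_cast
  nlinarith

/-- The second clause strengthens the induction: it stands in for `w` lying in the convex hull of
`v`, tested on balls only, and controls the distance from the new apex to the subdivided faces. -/
lemma subdiv_single_mem (k : ℕ) (v : Fin (k + 1) → stdSimplex ℝ ι) (r : ℝ) (hv : v ∈ meshLE ι k r) :
    subdiv tupleBarycenter k (Finsupp.single v (1 : R)) ∈ Finsupp.supported R R
      {w | w ∈ meshLE ι k (k / (k + 1) * r) ∧
        ∀ p s, (∀ j, dist (v j) p ≤ s) → ∀ i, dist (w i) p ≤ s} := by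
  have hr : 0 ≤ r := dist_nonneg.trans (hv 0 0)
  induction k with
  | zero =>
    refine Finsupp.single_mem_supported _ _ ⟨fun i j => ?_, fun p s h i => h i⟩
    obtain rfl : i = j := by fin_cases i; fin_cases j; rfl
    simp
  | succ k ih =>
    rw [subdiv_single]
    have h1 : subdiv tupleBarycenter k (tupleBoundary k (Finsupp.single v (1 : R))) ∈
        Finsupp.supported R R {w | w ∈ meshLE ι k (k / (k + 1) * r) ∧
          ∀ p s, (∀ j, dist (v j) p ≤ s) → ∀ i, dist (w i) p ≤ s} := by
      have h2 : tupleBoundary k (Finsupp.single v (1 : R)) ∈ Finsupp.supported R R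
          {w | w ∈ meshLE ι k r ∧ ∀ p s, (∀ j, dist (v j) p ≤ s) → ∀ i, dist (w i) p ≤ s} :=
        tupleBoundary_single_mem k fun i => And.intro (fun a b => hv _ _) fun p s h j => h _
      refine Finsupp.linearMap_mem_of_mem_supported _ (fun u hu => ?_) h2
      refine Finsupp.supported_mono (fun w hw => ?_) (ih u hu.1)
      exact ⟨hw.1, fun p s h => hw.2 p s (hu.2 p s h)⟩
    refine cone_mem_supported ?_ h1
    intro w hw
    refine ⟨fun i j => ?_, fun p s h i => ?_⟩
    -- The vertices of `v` lie in a ball of this radius around the barycenter, hence so do those of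
    -- `w`.
    · have hb : ∀ j, dist (w j) (tupleBarycenter (k + 1) v) ≤
          ((k + 1 : ℕ) : ℝ) / ((k + 1 : ℕ) + 1) * r := by
        refine hw.2 _ _ fun j => ?_
        have := stdSimplex.dist_affine_barycenter_le hv j
        rw [Fintype.card_fin] at this
        push_cast at this ⊢
        rwa [add_sub_cancel_right] at this
      cases i using Fin.cases with
      | zero =>
        cases j using Fin.cases with
        | zero => rw [dist_self]; positivity
        | succ j =>
          simp only [Fin.cons_zero, Fin.cons_succ]
          rw [dist_comm]; exact hb j
      | succ i =>
        cases j using Fin.cases with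
        | zero => simpa only [Fin.cons_zero, Fin.cons_succ] using hb i
        | succ j =>
          simp only [Fin.cons_succ]
          exact (hw.1 i j).trans (ratio_mono hr)
    · cases i using Fin.cases with
      | zero => exact stdSimplex.dist_affine_le h _
      | succ i => exact hw.2 p s h i

lemma subdiv_pow_single_mem (k : ℕ) (v : Fin (k + 1) → stdSimplex ℝ ι) (r : ℝ)
    (hv : v ∈ meshLE ι k r) (m : ℕ) :
    (subdiv tupleBarycenter k)^[m] (Finsupp.single v (1 : R)) ∈
      Finsupp.supported R R (meshLE ι k ((k / (k + 1)) ^ m * r)) := by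
  induction m with
  | zero => simpa using Finsupp.single_mem_supported R (1 : R) hv
  | succ m ih =>
    rw [Function.iterate_succ_apply']
    refine Finsupp.linearMap_mem_of_mem_supported _ (fun u hu => ?_) ih
    refine Finsupp.supported_mono (fun w hw => ?_) (subdiv_single_mem k u _ hu)
    have := hw.1
    rwa [← mul_assoc, ← pow_succ'] at this

end Mesh

end

/-! ### Subdivision of singular chains and small chains. -/

section

open CategoryTheory Limits Opposite

section Singular

variable {R : Type} [CommRing R] {Y : TopCat.{0}}

lemma toSSet_map_symm_comp_affine {ι : Type} [Fintype ι] (g : C(stdSimplex ℝ ι, Y))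
    {m m' : SimplexCategoryᵒᵖ} (f : m ⟶ m') (v : Fin (m.unop.len + 1) → stdSimplex ℝ ι) :
    (TopCat.toSSet.obj Y).map f ((Y.toSSetObjEquiv m).symm (g.comp (stdSimplex.affine v))) =
      (Y.toSSetObjEquiv m').symm (g.comp (stdSimplex.affine (v ∘ f.unop.toOrderHom))) := by
  apply (Y.toSSetObjEquiv m').injective
  rw [Equiv.apply_symm_apply]
  refine ContinuousMap.ext fun t => ?_
  refine (TopCat.toSSetObjEquiv_naturality_apply f.unop _ t).trans ?_
  refine (DFunLike.congr_fun (Equiv.apply_symm_apply (Y.toSSetObjEquiv m) _) _).trans ?_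
  exact congrArg g (stdSimplex.affine_map v f.unop.toOrderHom t)

/-- The singular simplices obtained by composing a fixed singular simplex with affine simplices. -/
noncomputable def pushTuples {n : ℕ} (σ : Simplices (TopCat.toSSet.obj Y) n) :
    tuples (stdSimplex ℝ (Fin (n + 1))) ⟶ TopCat.toSSet.obj Y where
  app m := ↾fun v => (Y.toSSetObjEquiv m).symm
    ((Y.toSSetObjEquiv (op (.mk n)) σ).comp (stdSimplex.affine v))
  naturality _ _ f := by
    ext v
    exact (toSSet_map_symm_comp_affine (Y.toSSetObjEquiv (op (.mk n)) σ) f v).symm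

lemma toSSetObjEquiv_pushTuples {n k : ℕ} (σ : Simplices (TopCat.toSSet.obj Y) n)
    (v : Fin (k + 1) → stdSimplex ℝ (Fin (n + 1))) :
    Y.toSSetObjEquiv (op (.mk k)) ((pushTuples σ).app (op (.mk k)) v) =
      (Y.toSSetObjEquiv (op (.mk n)) σ).comp (stdSimplex.affine v) :=
  Equiv.apply_symm_apply _ _

lemma pushTuples_vertex {n : ℕ} (σ : Simplices (TopCat.toSSet.obj Y) n) :
    (pushTuples σ).app (op (.mk n)) (stdSimplex.vertex : Fin (n + 1) → _) = σ := by
  apply (Y.toSSetObjEquiv (op (.mk n))).injective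
  rw [toSSetObjEquiv_pushTuples]
  ext t
  exact congrArg (Y.toSSetObjEquiv (op (.mk n)) σ) (stdSimplex.affine_vertices t)

lemma pushTuples_pushTuples {n k : ℕ} (σ : Simplices (TopCat.toSSet.obj Y) n)
    (v : Fin (k + 1) → stdSimplex ℝ (Fin (n + 1))) (l : ℕ)
    (w : Fin (l + 1) → stdSimplex ℝ (Fin (k + 1))) :
    (pushTuples ((pushTuples σ).app (op (.mk k)) v)).app (op (.mk l)) w =
      (pushTuples σ).app (op (.mk l)) (stdSimplex.affine v ∘ w) := by
  apply (Y.toSSetObjEquiv (op (.mk l))).injective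
  rw [toSSetObjEquiv_pushTuples, toSSetObjEquiv_pushTuples, toSSetObjEquiv_pushTuples]
  ext t
  exact congrArg (Y.toSSetObjEquiv (op (.mk n)) σ) (stdSimplex.affine_affine v w t)

/-- The pushforward of chains of tuples along a singular simplex. -/
noncomputable def pushChain {n : ℕ} (σ : Simplices (TopCat.toSSet.obj Y) n) (k : ℕ) :
    ((Fin (k + 1) → stdSimplex ℝ (Fin (n + 1))) →₀ R) →ₗ[R]
      (Simplices (TopCat.toSSet.obj Y) k →₀ R) :=
  Finsupp.lmapDomain R R ((pushTuples σ).app (op (.mk k)))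

lemma pushChain_single {n : ℕ} (σ : Simplices (TopCat.toSSet.obj Y) n) (k : ℕ)
    (v : Fin (k + 1) → stdSimplex ℝ (Fin (n + 1))) (a : R) :
    pushChain σ k (Finsupp.single v a) =
      Finsupp.single ((pushTuples σ).app (op (.mk k)) v) a :=
  Finsupp.mapDomain_single

lemma pushChain_vertex {n : ℕ} (σ : Simplices (TopCat.toSSet.obj Y) n) :
    pushChain σ n (Finsupp.single stdSimplex.vertex (1 : R)) = Finsupp.single σ 1 :=
  (Finsupp.mapDomain_single).trans (congrArg (fun x => Finsupp.single x 1) (pushTuples_vertex σ))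

lemma faceSum_pushChain {n : ℕ} (σ : Simplices (TopCat.toSSet.obj Y) n) (k : ℕ)
    (c : (Fin (k + 2) → stdSimplex ℝ (Fin (n + 1))) →₀ R) :
    faceSum R _ k (pushChain σ (k + 1) c) = pushChain σ k (tupleBoundary k c) :=
  (mapDomain_faceSum (pushTuples σ) k c).symm

lemma pushChain_pushTuples {n k : ℕ} (σ : Simplices (TopCat.toSSet.obj Y) n)
    (v : Fin (k + 1) → stdSimplex ℝ (Fin (n + 1))) (l : ℕ)
    (c : (Fin (l + 1) → stdSimplex ℝ (Fin (k + 1))) →₀ R) :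
    pushChain ((pushTuples σ).app (op (.mk k)) v) l c =
      pushChain σ l (c.mapDomain fun w => stdSimplex.affine v ∘ w) := by
  refine Eq.trans ?_ Finsupp.mapDomain_comp
  refine congrArg (fun f => Finsupp.mapDomain f c) (funext fun w => ?_)
  exact pushTuples_pushTuples σ v l w

/-- An operator on singular chains defined by its values on the standard simplices. -/
noncomputable def singularOperator (k l : ℕ)
    (c : (Fin (l + 1) → stdSimplex ℝ (Fin (k + 1))) →₀ R) :
    (Simplices (TopCat.toSSet.obj Y) k →₀ R) →ₗ[R] (Simplices (TopCat.toSSet.obj Y) l →₀ R) :=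
  Finsupp.linearCombination R fun σ => pushChain σ l c

lemma singularOperator_single {k l : ℕ} (c : (Fin (l + 1) → stdSimplex ℝ (Fin (k + 1))) →₀ R)
    (σ : Simplices (TopCat.toSSet.obj Y) k) :
    singularOperator k l c (Finsupp.single σ 1) = pushChain σ l c := by
  rw [singularOperator, Finsupp.linearCombination_single, one_smul]

/-- Barycentric subdivision of singular chains. -/
noncomputable def singularSubdiv (k : ℕ) :
    (Simplices (TopCat.toSSet.obj Y) k →₀ R) →ₗ[R] (Simplices (TopCat.toSSet.obj Y) k →₀ R) :=
  singularOperator k k (subdiv tupleBarycenter k (Finsupp.single stdSimplex.vertex 1))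

/-- The homotopy between barycentric subdivision of singular chains and the identity. -/
noncomputable def singularSubdivHomotopy (k : ℕ) :
    (Simplices (TopCat.toSSet.obj Y) k →₀ R) →ₗ[R] (Simplices (TopCat.toSSet.obj Y) (k + 1) →₀ R) :=
  singularOperator k (k + 1) (subdivHomotopy tupleBarycenter k (Finsupp.single stdSimplex.vertex 1))

lemma affine_comp_vertex {ι : Type} [Fintype ι] {k : ℕ} (v : Fin (k + 1) → stdSimplex ℝ ι) :
    stdSimplex.affine v ∘ (stdSimplex.vertex : Fin (k + 1) → _) = v :=
  funext fun j => stdSimplex.affine_vertex v j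

/-- Naturality of `subdiv` under the affine map with vertices `v`. It transports every identity for
tuples to singular chains. -/
lemma singularSubdiv_pushChain {n : ℕ} (σ : Simplices (TopCat.toSSet.obj Y) n) (k : ℕ)
    (c : (Fin (k + 1) → stdSimplex ℝ (Fin (n + 1))) →₀ R) :
    singularSubdiv k (pushChain σ k c) = pushChain σ k (subdiv tupleBarycenter k c) := by
  suffices h : singularSubdiv k ∘ₗ pushChain (R := R) σ k =
      pushChain σ k ∘ₗ subdiv tupleBarycenter k from LinearMap.congr_fun h c
  clear c
  refine Finsupp.lhom_ext' fun v => LinearMap.ext_ring ?_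
  change singularSubdiv k (pushChain σ k (Finsupp.single v 1)) =
    pushChain σ k (subdiv tupleBarycenter k (Finsupp.single v 1))
  rw [pushChain_single]
  refine (singularOperator_single _ _).trans ?_
  rw [pushChain_pushTuples, mapDomain_subdiv (γ := tupleBarycenter)
    (fun k w => affine_tupleBarycenter v k w), Finsupp.mapDomain_single, affine_comp_vertex]

lemma singularSubdivHomotopy_pushChain {n : ℕ} (σ : Simplices (TopCat.toSSet.obj Y) n) (k : ℕ)
    (c : (Fin (k + 1) → stdSimplex ℝ (Fin (n + 1))) →₀ R) :
    singularSubdivHomotopy k (pushChain σ k c) =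
      pushChain σ (k + 1) (subdivHomotopy tupleBarycenter k c) := by
  suffices h : singularSubdivHomotopy k ∘ₗ pushChain (R := R) σ k =
      pushChain σ (k + 1) ∘ₗ subdivHomotopy tupleBarycenter k from LinearMap.congr_fun h c
  clear c
  refine Finsupp.lhom_ext' fun v => LinearMap.ext_ring ?_
  change singularSubdivHomotopy k (pushChain σ k (Finsupp.single v 1)) =
    pushChain σ (k + 1) (subdivHomotopy tupleBarycenter k (Finsupp.single v 1))
  rw [pushChain_single]
  refine (singularOperator_single _ _).trans ?_
  rw [pushChain_pushTuples, mapDomain_subdivHomotopy (γ := tupleBarycenter)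
    (fun k w => affine_tupleBarycenter v k w), Finsupp.mapDomain_single, affine_comp_vertex]

/-- Each singular simplex is the pushforward along itself of the identity of the standard simplex,
here the tuple `stdSimplex.vertex`. -/
lemma singular_lhom_ext {k : ℕ} {M : Type*} [AddCommGroup M] [Module R M]
    {f g : (Simplices (TopCat.toSSet.obj Y) k →₀ R) →ₗ[R] M}
    (h : ∀ σ, f (pushChain σ k (Finsupp.single stdSimplex.vertex 1)) =
      g (pushChain σ k (Finsupp.single stdSimplex.vertex 1))) : f = g := by
  refine Finsupp.lhom_ext' fun σ => LinearMap.ext_ring ?_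
  have := h σ
  rw [pushChain_vertex] at this
  exact this

lemma faceSum_singularSubdiv (k : ℕ) (z : Simplices (TopCat.toSSet.obj Y) (k + 1) →₀ R) :
    faceSum R _ k (singularSubdiv (k + 1) z) = singularSubdiv k (faceSum R _ k z) := by
  suffices h : faceSum R (TopCat.toSSet.obj Y) k ∘ₗ singularSubdiv (k + 1) =
      singularSubdiv k ∘ₗ faceSum R _ k from LinearMap.congr_fun h z
  refine singular_lhom_ext fun σ => ?_
  simp only [LinearMap.comp_apply]
  rw [singularSubdiv_pushChain, faceSum_pushChain, faceSum_pushChain, singularSubdiv_pushChain,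
    tupleBoundary_subdiv]

lemma faceSum_singularSubdivHomotopy (k : ℕ)
    (z : Simplices (TopCat.toSSet.obj Y) (k + 1) →₀ R) :
    faceSum R _ (k + 1) (singularSubdivHomotopy (k + 1) z) +
      singularSubdivHomotopy k (faceSum R _ k z) = z - singularSubdiv (k + 1) z := by
  suffices h : faceSum R (TopCat.toSSet.obj Y) (k + 1) ∘ₗ singularSubdivHomotopy (k + 1) +
      singularSubdivHomotopy k ∘ₗ faceSum R _ k = LinearMap.id - singularSubdiv (k + 1) from
    LinearMap.congr_fun h z
  refine singular_lhom_ext fun σ => ?_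
  simp only [LinearMap.comp_apply, LinearMap.add_apply, LinearMap.sub_apply, LinearMap.id_apply]
  rw [singularSubdivHomotopy_pushChain, faceSum_pushChain, faceSum_pushChain,
    singularSubdivHomotopy_pushChain, singularSubdiv_pushChain, ← map_add, ← map_sub,
    tupleBoundary_subdivHomotopy]

lemma singularSubdiv_zero (z : Simplices (TopCat.toSSet.obj Y) 0 →₀ R) :
    singularSubdiv 0 z = z := by
  suffices h : singularSubdiv (R := R) (Y := Y) 0 = LinearMap.id from LinearMap.congr_fun h z
  refine singular_lhom_ext fun σ => ?_
  rw [singularSubdiv_pushChain]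
  rfl

/-- The singular simplices contained in a subset of a space. -/
def singularIn (U : Set Y) : (TopCat.toSSet.obj Y).Subcomplex where
  obj n := {σ | ∀ t, Y.toSSetObjEquiv n σ t ∈ U}
  map {_ _} f _ hσ t := hσ (stdSimplex.map f.unop.toOrderHom t)

lemma mem_singularIn {U : Set Y} {n : SimplexCategoryᵒᵖ} {σ : (TopCat.toSSet.obj Y).obj n} :
    σ ∈ (singularIn U).obj n ↔ ∀ t, Y.toSSetObjEquiv n σ t ∈ U := Iff.rfl

lemma pushTuples_mem_singularIn {U : Set Y} {n : ℕ} {σ : Simplices (TopCat.toSSet.obj Y) n}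
    (hσ : σ ∈ (singularIn U).obj (op (.mk n))) {k : ℕ}
    (v : Fin (k + 1) → stdSimplex ℝ (Fin (n + 1))) :
    (pushTuples σ).app (op (.mk k)) v ∈ (singularIn U).obj (op (.mk k)) := by
  rw [mem_singularIn, toSSetObjEquiv_pushTuples]
  exact fun t => hσ _

variable {U V : Set Y}

/-- The chains which are supported on simplices contained in `U` or in `V`. -/
def smallChains (R : Type) [CommRing R] (U V : Set Y) (k : ℕ) :
    Submodule R (Simplices (TopCat.toSSet.obj Y) k →₀ R) :=
  Finsupp.supported R R ((singularIn U ⊔ singularIn V).obj (op (.mk k)))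

lemma pushTuples_mem_sup {n : ℕ} {σ : Simplices (TopCat.toSSet.obj Y) n}
    (hσ : σ ∈ (singularIn U ⊔ singularIn V).obj (op (.mk n))) {k : ℕ}
    (v : Fin (k + 1) → stdSimplex ℝ (Fin (n + 1))) :
    (pushTuples σ).app (op (.mk k)) v ∈ (singularIn U ⊔ singularIn V).obj (op (.mk k)) :=
  hσ.imp (pushTuples_mem_singularIn · v) (pushTuples_mem_singularIn · v)

lemma singularOperator_mem_smallChains {k l : ℕ}
    (c : (Fin (l + 1) → stdSimplex ℝ (Fin (k + 1))) →₀ R)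
    {z : Simplices (TopCat.toSSet.obj Y) k →₀ R} (hz : z ∈ smallChains R U V k) :
    singularOperator (R := R) k l c z ∈ smallChains R U V l := by
  refine Finsupp.linearMap_mem_of_mem_supported _ (fun σ hσ => ?_) hz
  rw [singularOperator_single]
  exact Finsupp.mapDomain_mem_supported (s := Set.univ) (fun v _ => pushTuples_mem_sup hσ v)
    (by simp)

/-- For a relative cycle `z`, the homotopy shows that `z` and its subdivision differ by a boundary
plus a small chain, because the operators defined on standard simplices preserve small chains.
Iterate `m` times. -/
lemma exists_sub_faceSum_mem_smallChains (k m : ℕ)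
    (z : Simplices (TopCat.toSSet.obj Y) (k + 1) →₀ R)
    (hz : faceSum R _ k z ∈ smallChains R U V k)
    (hm : (singularSubdiv (k + 1))^[m] z ∈ smallChains R U V (k + 1)) :
    ∃ w, z - faceSum R _ (k + 1) w ∈ smallChains R U V (k + 1) := by
  induction m generalizing z with
  | zero => exact ⟨0, by simpa using hm⟩
  | succ m ih =>
    obtain ⟨w, hw⟩ := ih (singularSubdiv (k + 1) z)
      (by rw [faceSum_singularSubdiv]; exact singularOperator_mem_smallChains _ hz) hm
    refine ⟨w + singularSubdivHomotopy (k + 1) z, ?_⟩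
    have h1 := faceSum_singularSubdivHomotopy k z
    have h2 : singularSubdivHomotopy k (faceSum R _ k z) ∈ smallChains R U V (k + 1) :=
      singularOperator_mem_smallChains _ hz
    have h3 : z - faceSum R _ (k + 1) (w + singularSubdivHomotopy (k + 1) z) =
        (singularSubdiv (k + 1) z - faceSum R _ (k + 1) w) +
          singularSubdivHomotopy k (faceSum R _ k z) := by
      rw [map_add, eq_sub_of_add_eq h1]
      abel
    rw [h3]
    exact Submodule.add_mem _ hw h2

lemma iterate_singularSubdiv_pushChain {n : ℕ} (σ : Simplices (TopCat.toSSet.obj Y) n) (k m : ℕ)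
    (c : (Fin (k + 1) → stdSimplex ℝ (Fin (n + 1))) →₀ R) :
    (singularSubdiv k)^[m] (pushChain σ k c) =
      pushChain σ k ((subdiv tupleBarycenter k)^[m] c) := by
  induction m with
  | zero => rfl
  | succ m ih => rw [Function.iterate_succ_apply', Function.iterate_succ_apply', ih,
      singularSubdiv_pushChain]

lemma meshLE_vertex (k : ℕ) :
    (stdSimplex.vertex : Fin (k + 1) → stdSimplex ℝ (Fin (k + 1))) ∈ meshLE (Fin (k + 1)) k 1 :=
  fun i j => (Metric.dist_le_diam_of_mem (bounded_stdSimplex _) (stdSimplex.vertex i).2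
    (stdSimplex.vertex j).2).trans diam_stdSimplex_le

/-- The mesh after `m` subdivisions is at most `(k / (k + 1)) ^ m`, eventually below a Lebesgue
number of the pulled back cover. Demanding this for all `m ≥ N` lets finitely many simplices share
one `N`. -/
lemma exists_iterate_singularSubdiv_single_mem (hU : IsOpen U) (hV : IsOpen V)
    (hUV : U ∪ V = Set.univ) {k : ℕ} (σ : Simplices (TopCat.toSSet.obj Y) k) :
    ∃ N, ∀ m, N ≤ m →
      (singularSubdiv k)^[m] (Finsupp.single σ (1 : R)) ∈ smallChains R U V k := by
  set g : C(stdSimplex ℝ (Fin (k + 1)), Y) := Y.toSSetObjEquiv (op (.mk k)) σ with hg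
  obtain ⟨δ, hδ, hball⟩ := lebesgue_number_lemma_of_metric
    (s := (Set.univ : Set (stdSimplex ℝ (Fin (k + 1))))) (c := fun b : Bool => g ⁻¹' (cond b U V))
    isCompact_univ (fun b => by
      cases b
      exacts [hV.preimage g.continuous, hU.preimage g.continuous])
    (fun x _ => by
      have : g x ∈ U ∪ V := hUV ▸ Set.mem_univ _
      rcases this with h | h
      · exact Set.mem_iUnion.2 ⟨true, h⟩
      · exact Set.mem_iUnion.2 ⟨false, h⟩)
  have hlim := tendsto_pow_atTop_nhds_zero_of_lt_one (r := (k : ℝ) / (k + 1)) (by positivity)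
    (by rw [div_lt_one (by positivity)]; linarith)
  obtain ⟨N, hN⟩ := Filter.eventually_atTop.1 (hlim.eventually (gt_mem_nhds hδ))
  refine ⟨N, fun m hm => ?_⟩
  rw [← pushChain_vertex, iterate_singularSubdiv_pushChain]
  refine Finsupp.mapDomain_mem_supported (fun w hw => ?_)
    (subdiv_pow_single_mem k _ 1 (meshLE_vertex k) m)
  -- The ball around the first vertex contains the whole affine simplex, by convexity, and decides
  -- between `U` and `V`.
  obtain ⟨b, hb⟩ := hball (w 0) (Set.mem_univ _)
  have hmem : ∀ t, g (stdSimplex.affine w t) ∈ (cond b U V : Set Y) := fun t => by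
    refine hb (lt_of_le_of_lt (stdSimplex.dist_affine_le (fun j => hw j 0) t) ?_)
    rw [mul_one]
    exact hN m hm
  cases b with
  | true => exact Or.inl fun t => by rw [toSSetObjEquiv_pushTuples]; exact hmem t
  | false => exact Or.inr fun t => by rw [toSSetObjEquiv_pushTuples]; exact hmem t

lemma exists_iterate_singularSubdiv_mem (hU : IsOpen U) (hV : IsOpen V)
    (hUV : U ∪ V = Set.univ) {k : ℕ} (z : Simplices (TopCat.toSSet.obj Y) k →₀ R) :
    ∃ N, ∀ m, N ≤ m → (singularSubdiv k)^[m] z ∈ smallChains R U V k := by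
  have hpow (m : ℕ) : ∃ L : (Simplices (TopCat.toSSet.obj Y) k →₀ R) →ₗ[R]
      (Simplices (TopCat.toSSet.obj Y) k →₀ R), ⇑L = (singularSubdiv k)^[m] := by
    induction m with
    | zero => exact ⟨LinearMap.id, rfl⟩
    | succ m ih =>
      obtain ⟨L, hL⟩ := ih
      exact ⟨L ∘ₗ singularSubdiv k, by rw [LinearMap.coe_comp, hL, Function.iterate_succ]⟩
  induction z using Finsupp.induction_linear with
  | zero =>
    refine ⟨0, fun m _ => ?_⟩
    obtain ⟨L, hL⟩ := hpow m
    rw [← hL, map_zero]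
    exact Submodule.zero_mem _
  | add x y hx hy =>
    obtain ⟨N, hN⟩ := hx
    obtain ⟨N', hN'⟩ := hy
    refine ⟨max N N', fun m hm => ?_⟩
    obtain ⟨L, hL⟩ := hpow m
    rw [← hL, map_add, hL]
    exact Submodule.add_mem _ (hN m (by omega)) (hN' m (by omega))
  | single σ a =>
    obtain ⟨N, hN⟩ := exists_iterate_singularSubdiv_single_mem (R := R) hU hV hUV σ
    refine ⟨N, fun m hm => ?_⟩
    obtain ⟨L, hL⟩ := hpow m
    rw [← hL, ← mul_one a, ← smul_eq_mul, ← Finsupp.smul_single, map_smul, hL]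
    exact Submodule.smul_mem _ _ (hN m hm)

lemma range_freeChains_map_ι_f {X : SSet.{0}} (A : X.Subcomplex) (k : ℕ)
    (z : Simplices X k →₀ R) :
    (∃ y, ((freeChains R).map A.ι).f k y = z) ↔
      z ∈ Finsupp.supported R R (A.obj (op (.mk k))) := by
  refine (Finsupp.mem_range_mapDomain_iff (f := A.ι.app (op (.mk k)))
    Subtype.val_injective z).trans ?_
  rw [Finsupp.mem_supported']
  refine forall_congr' fun x => imp_congr_left (not_congr ?_)
  exact ⟨fun ⟨y, hy⟩ => hy ▸ y.2, fun hx => ⟨⟨x, hx⟩, rfl⟩⟩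

lemma quasiIso_smallChains (hU : IsOpen U) (hV : IsOpen V) (hUV : U ∪ V = Set.univ) :
    QuasiIso ((freeChains R).map (singularIn U ⊔ singularIn V).ι) := by
  refine HomologicalComplex.quasiIso_of_injective _ (fun n => freeChains_map_f_injective _ n) ?_
  intro n z hz
  cases n with
  | zero =>
    obtain ⟨N, hN⟩ := exists_iterate_singularSubdiv_mem (R := R) hU hV hUV z
    refine ⟨0, ?_⟩
    rw [map_zero, sub_zero]
    refine (range_freeChains_map_ι_f _ _ _).2 ?_
    -- Subdivision fixes `0`-chains, so all of them are already small.
    have : (singularSubdiv 0)^[N] z = z := Function.iterate_fixed (singularSubdiv_zero z) N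
    rw [← this]
    exact hN N le_rfl
  | succ n =>
    obtain ⟨N, hN⟩ := exists_iterate_singularSubdiv_mem (R := R) hU hV hUV z
    rw [ChainComplex.next_nat_succ] at hz
    have hz' := (range_freeChains_map_ι_f _ _ _).1 hz
    have e : ((freeChains R).obj (TopCat.toSSet.obj Y)).d (n + 1) n z = faceSum R _ n z :=
      LinearMap.congr_fun (freeChains_d_hom R (TopCat.toSSet.obj Y) n) z
    rw [e] at hz'
    obtain ⟨w, hw⟩ := exists_sub_faceSum_mem_smallChains n N z hz' (hN N le_rfl)
    refine ⟨w, (range_freeChains_map_ι_f _ _ _).2 ?_⟩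
    have e' : ((freeChains R).obj (TopCat.toSSet.obj Y)).d (n + 2) (n + 1) w =
      faceSum R _ (n + 1) w :=
      LinearMap.congr_fun (freeChains_d_hom R (TopCat.toSSet.obj Y) (n + 1)) w
    rw [e']
    exact hw

end Singular

end

/-! ### Euler characteristics of spaces and Mayer-Vietoris for open covers. -/

section

open CategoryTheory Limits Opposite

section HasEulerData

variable (R : Type) [CommRing R]

/-- The singular homology of `Y` with coefficients in `R` is finitely generated, and its Euler
characteristic is `e`. -/
def HasEulerData (Y : Type) [TopologicalSpace Y] (e : ℤ) : Prop :=
  EulerData (((AlgebraicTopology.singularChainComplexFunctor (ModuleCat.{0} R)).obj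
    (ModuleCat.of R R)).obj (TopCat.of Y)) e

variable {R} {Y Z : Type} [TopologicalSpace Y] [TopologicalSpace Z] {e e' : ℤ}

lemma hasEulerData_iff : HasEulerData R Y e ↔
    EulerData ((freeChains R).obj (TopCat.toSSet.obj (TopCat.of Y))) e :=
  let i := (chainComplexIsoFreeChains R).app (TopCat.toSSet.obj (TopCat.of Y))
  have : QuasiIso i.hom := inferInstance
  ⟨fun h => EulerData.of_quasiIso i.hom h, fun h => @EulerData.of_quasiIso' _ _ _ _ _ i.hom this h⟩

namespace HasEulerData

lemma of_homotopyEquiv (h : HasEulerData R Y e) (f : ContinuousMap.HomotopyEquiv Y Z) :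
    HasEulerData R Z e := by
  let F := (AlgebraicTopology.singularChainComplexFunctor (ModuleCat.{0} R)).obj (ModuleCat.of R R)
  let φ : TopCat.of Y ⟶ TopCat.of Z := TopCat.ofHom f.toFun
  let ψ : TopCat.of Z ⟶ TopCat.of Y := TopCat.ofHom f.invFun
  have H : TopCat.Homotopy (φ ≫ ψ) (𝟙 (TopCat.of Y)) := f.left_inv.some
  have H' : TopCat.Homotopy (ψ ≫ φ) (𝟙 (TopCat.of Z)) := f.right_inv.some
  let E : _root_.HomotopyEquiv (F.obj (TopCat.of Y)) (F.obj (TopCat.of Z)) :=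
    { hom := F.map φ
      inv := F.map ψ
      homotopyHomInvId := ((Homotopy.ofEq (F.map_comp φ ψ).symm).trans
        (H.singularChainComplexFunctorObjMap _)).trans (Homotopy.ofEq (F.map_id _))
      homotopyInvHomId := ((Homotopy.ofEq (F.map_comp ψ φ).symm).trans
        (H'.singularChainComplexFunctorObjMap _)).trans (Homotopy.ofEq (F.map_id _)) }
  have : QuasiIso E.hom := E.quasiIso_hom
  exact EulerData.of_quasiIso E.hom h

lemma of_homeomorph (h : HasEulerData R Y e) (f : Y ≃ₜ Z) : HasEulerData R Z e :=
  h.of_homotopyEquiv f.toHomotopyEquiv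

variable [IsDomain R]

lemma punit : HasEulerData R PUnit 1 := by
  let F := (AlgebraicTopology.singularChainComplexFunctor (ModuleCat.{0} R)).obj (ModuleCat.of R R)
  have h0 (n : ℕ) (hn : n ≠ 0) : Subsingleton ((F.obj (TopCat.of PUnit)).homology n) :=
    ModuleCat.subsingleton_of_isZero
      (AlgebraicTopology.isZero_singularHomologyFunctor_of_totallyDisconnectedSpace
        (ModuleCat.{0} R) n (ModuleCat.of R R) (TopCat.of PUnit) hn)
  let i : (F.obj (TopCat.of PUnit)).homology 0 ≃ₗ[R] R :=
    ((AlgebraicTopology.singularHomologyFunctorZeroOfTotallyDisconnectedSpace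
        (ModuleCat.{0} R) (ModuleCat.of R R) (TopCat.of PUnit)) ≪≫
      ((sigmaConstIsoFree R).app PUnit)).toLinearEquiv.trans
        (Finsupp.uniqueLinearEquiv R R PUnit.unit)
  refine ⟨fun n => ?_, 1, fun n hn => h0 n (by omega), ?_⟩
  · cases n with
    | zero => exact Module.Finite.equiv i.symm
    | succ n =>
      have := h0 (n + 1) (by omega)
      exact inferInstance
  · rw [Finset.sum_range_one, pow_zero, one_mul]
    exact congrArg Nat.cast (i.finrank_eq.trans (Module.finrank_self R))

lemma of_contractible [ContractibleSpace Y] : HasEulerData R Y 1 :=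
  (punit (R := R)).of_homotopyEquiv (ContractibleSpace.hequiv_unit Y).some.symm

omit [IsDomain R] in
lemma of_isEmpty [IsEmpty Y] : HasEulerData R Y 0 := by
  rw [hasEulerData_iff]
  have h (n : ℕ) : Subsingleton (((freeChains R).obj
      (TopCat.toSSet.obj (TopCat.of Y))).homology n) := by
    have : IsEmpty (Simplices (TopCat.toSSet.obj (TopCat.of Y)) n) :=
      ⟨fun σ => isEmptyElim ((TopCat.of Y).toSSetObjEquiv _ σ (stdSimplex.vertex 0) : Y)⟩
    have h0 : IsZero (((freeChains R).obj (TopCat.toSSet.obj (TopCat.of Y))).X n) :=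
      @ModuleCat.isZero_of_subsingleton _ _ _ (inferInstanceAs
        (Subsingleton (Simplices (TopCat.toSSet.obj (TopCat.of Y)) n →₀ R)))
    exact ModuleCat.subsingleton_of_isZero (HomologicalComplex.ExactAt.isZero_homology
      (ShortComplex.exact_of_isZero_X₂ _ h0))
  exact ⟨fun n => inferInstance, 0, fun n _ => h n, rfl⟩

end HasEulerData

end HasEulerData

section MayerVietoris

variable {R : Type} [CommRing R] {Y : TopCat.{0}}

/-- The singular simplices of a subspace, as singular simplices contained in a subset. -/
noncomputable def toSingularIn (U : Set Y) :
    TopCat.toSSet.obj (TopCat.of U) ⟶ (singularIn U : SSet) :=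
  SSet.Subcomplex.lift (TopCat.toSSet.map (TopCat.ofHom ⟨Subtype.val, continuous_subtype_val⟩)) (by
    rintro n _ ⟨σ, rfl⟩ t
    exact ((TopCat.of U).toSSetObjEquiv n σ t).2)

instance (U : Set Y) : IsIso (toSingularIn U) := by
  rw [NatTrans.isIso_iff_isIso_app]
  intro n
  rw [isIso_iff_bijective]
  refine ⟨fun σ τ h => ?_, fun τ => ?_⟩
  · apply ((TopCat.of U).toSSetObjEquiv n).injective
    ext t
    have := congrArg (fun x => Y.toSSetObjEquiv n x.1 t) h
    exact this
  · refine ⟨((TopCat.of U).toSSetObjEquiv n).symm ⟨fun t => ⟨Y.toSSetObjEquiv n τ.1 t, τ.2 t⟩,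
      by fun_prop⟩, Subtype.ext ?_⟩
    exact (Y.toSSetObjEquiv n).injective (by ext t; rfl)

lemma hasEulerData_iff_singularIn (U : Set Y) (e : ℤ) :
    HasEulerData R U e ↔ EulerData ((freeChains R).obj (singularIn U)) e :=
  hasEulerData_iff.trans ⟨fun h => EulerData.of_quasiIso ((freeChains R).map (toSingularIn U)) h,
    fun h => EulerData.of_quasiIso' ((freeChains R).map (toSingularIn U)) h⟩

lemma singularIn_inf (U V : Set Y) : singularIn U ⊓ singularIn V = singularIn (U ∩ V) := by
  ext n σ
  exact forall_and.symm

end MayerVietoris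

namespace HasEulerData

variable {R : Type} [CommRing R] [IsDomain R] [IsNoetherianRing R] {Y : Type} [TopologicalSpace Y]
  {U V : Set Y} {a b c : ℤ}

/-- The Mayer-Vietoris formula for the Euler characteristic of a union. -/
lemma of_open_cover (hU : IsOpen U) (hV : IsOpen V) (hUV : U ∪ V = Set.univ)
    (ha : HasEulerData R U a) (hb : HasEulerData R V b)
    (hc : HasEulerData R (U ∩ V : Set Y) c) : HasEulerData R Y (a + b - c) := by
  have := quasiIso_smallChains (Y := TopCat.of Y) (R := R) hU hV hUV
  refine hasEulerData_iff.2 (EulerData.of_quasiIso ((freeChains R).map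
    (singularIn (Y := TopCat.of Y) U ⊔ singularIn (Y := TopCat.of Y) V).ι) ?_)
  refine EulerData.freeChains_sup ((hasEulerData_iff_singularIn (Y := TopCat.of Y) U a).1 ha)
    ((hasEulerData_iff_singularIn (Y := TopCat.of Y) V b).1 hb) ?_
  rw [singularIn_inf]
  exact (hasEulerData_iff_singularIn (Y := TopCat.of Y) _ c).1 hc

/-- The Mayer-Vietoris formula for the Euler characteristic of an intersection. -/
lemma inter_of_open_cover (hU : IsOpen U) (hV : IsOpen V) (hUV : U ∪ V = Set.univ)
    (ha : HasEulerData R U a) (hb : HasEulerData R V b)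
    (hc : HasEulerData R Y c) : HasEulerData R (U ∩ V : Set Y) (a + b - c) := by
  have := quasiIso_smallChains (Y := TopCat.of Y) (R := R) hU hV hUV
  refine (hasEulerData_iff_singularIn (Y := TopCat.of Y) _ _).2 ?_
  rw [← singularIn_inf]
  refine EulerData.freeChains_inf ((hasEulerData_iff_singularIn (Y := TopCat.of Y) U a).1 ha)
    ((hasEulerData_iff_singularIn (Y := TopCat.of Y) V b).1 hb) ?_
  exact EulerData.of_quasiIso' ((freeChains R).map
    (singularIn (Y := TopCat.of Y) U ⊔ singularIn (Y := TopCat.of Y) V).ι) (hasEulerData_iff.1 hc)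

end HasEulerData

end

/-! ### Attaching a cell to a space. -/

section

open CategoryTheory Limits Opposite Topology

namespace stdSimplex

variable {ι : Type} [Fintype ι] [Nonempty ι]

/-- The smallest barycentric coordinate of a point of a simplex. -/
noncomputable def minCoord (x : stdSimplex ℝ ι) : ℝ :=
  Finset.univ.inf' Finset.univ_nonempty fun i => x i

lemma continuous_minCoord : Continuous (minCoord (ι := ι)) :=
  Continuous.finset_inf'_apply _ fun i _ => (continuous_apply i).comp continuous_subtype_val

lemma minCoord_le (x : stdSimplex ℝ ι) (i : ι) : minCoord x ≤ x i :=
  Finset.inf'_le _ (Finset.mem_univ i)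

lemma exists_minCoord_eq (x : stdSimplex ℝ ι) : ∃ i, minCoord x = x i := by
  obtain ⟨i, -, hi⟩ := Finset.exists_mem_eq_inf' Finset.univ_nonempty fun i => x i
  exact ⟨i, hi⟩

lemma minCoord_nonneg (x : stdSimplex ℝ ι) : 0 ≤ minCoord x := by
  obtain ⟨i, hi⟩ := exists_minCoord_eq x
  exact hi ▸ x.2.1 i

lemma minCoord_eq_zero_iff (x : stdSimplex ℝ ι) : minCoord x = 0 ↔ ∃ i, x i = 0 := by
  refine ⟨fun h => ?_, fun ⟨i, hi⟩ => le_antisymm (hi ▸ minCoord_le x i) (minCoord_nonneg x)⟩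
  obtain ⟨i, hi⟩ := exists_minCoord_eq x
  exact ⟨i, hi ▸ h⟩

lemma card_mul_minCoord_le (x : stdSimplex ℝ ι) : Fintype.card ι * minCoord x ≤ 1 := by
  have := Finset.card_nsmul_le_sum Finset.univ (fun i => x i) _ fun i _ => minCoord_le x i
  rw [nsmul_eq_mul, Finset.card_univ] at this
  exact this.trans_eq x.2.2

variable (ι) in
/-- The width of the collar of the boundary of a simplex. -/
noncomputable def collarWidth : ℝ := (2 * Fintype.card ι : ℝ)⁻¹

lemma collarWidth_pos : 0 < collarWidth ι := by
  have : 0 < Fintype.card ι := Fintype.card_pos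
  rw [collarWidth]
  positivity

lemma card_mul_collarWidth : Fintype.card ι * collarWidth ι = 1 / 2 := by
  have : (Fintype.card ι : ℝ) ≠ 0 := Nat.cast_ne_zero.2 Fintype.card_ne_zero
  rw [collarWidth]
  field_simp

/-- The amount subtracted from all coordinates when pushing a point towards the boundary. -/
noncomputable def pushAmount (s : ℝ) (x : stdSimplex ℝ ι) : ℝ :=
  s * min (minCoord x) (collarWidth ι)

lemma pushAmount_nonneg {s : ℝ} (hs : 0 ≤ s) (x : stdSimplex ℝ ι) : 0 ≤ pushAmount s x :=
  mul_nonneg hs (le_min (minCoord_nonneg x) collarWidth_pos.le)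

lemma pushAmount_le {s : ℝ} (hs : s ≤ 1) (x : stdSimplex ℝ ι) :
    pushAmount s x ≤ min (minCoord x) (collarWidth ι) :=
  mul_le_of_le_one_left (le_min (minCoord_nonneg x) collarWidth_pos.le) hs

/-- The collar width is half the coordinate `1 / card ι` of the barycenter, which keeps the
denominator in `push` at least `1 / 2`. -/
lemma card_mul_pushAmount_le {s : ℝ} (hs : s ≤ 1) (x : stdSimplex ℝ ι) :
    Fintype.card ι * pushAmount s x ≤ 1 / 2 :=
  (mul_le_mul_of_nonneg_left ((pushAmount_le hs x).trans (min_le_right _ _))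
    (Nat.cast_nonneg _)).trans_eq card_mul_collarWidth

lemma pushAmount_pos_denom {s : ℝ} (hs : s ≤ 1) (x : stdSimplex ℝ ι) :
    0 < 1 - Fintype.card ι * pushAmount s x := by
  linarith [card_mul_pushAmount_le hs x]

/-- The map pushing a collar of the boundary of a simplex to the boundary. -/
noncomputable def push (s : unitInterval) (x : stdSimplex ℝ ι) : stdSimplex ℝ ι :=
  -- Subtracting a constant from all coordinates and rescaling moves `x` along the ray from the
  -- barycenter.
  ⟨fun i => (x i - pushAmount s x) / (1 - Fintype.card ι * pushAmount s x), fun i =>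
    div_nonneg (sub_nonneg.2 (((pushAmount_le s.2.2 x).trans (min_le_left _ _)).trans
      (minCoord_le x i))) (pushAmount_pos_denom s.2.2 x).le, by
    have : ∑ i, x i = 1 := x.2.2
    rw [← Finset.sum_div, Finset.sum_sub_distrib, this, Finset.sum_const, nsmul_eq_mul,
      Finset.card_univ, div_self (pushAmount_pos_denom s.2.2 x).ne']⟩

lemma push_apply (s : unitInterval) (x : stdSimplex ℝ ι) (i : ι) : push s x i =
    (x i - pushAmount s x) / (1 - Fintype.card ι * pushAmount s x) := rfl

lemma continuous_push : Continuous fun p : stdSimplex ℝ ι × unitInterval => push p.2 p.1 := by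
  refine Continuous.subtype_mk (continuous_pi fun i => ?_) _
  have h : Continuous fun p : stdSimplex ℝ ι × unitInterval => pushAmount p.2 p.1 :=
    (continuous_subtype_val.comp continuous_snd).mul
      ((continuous_minCoord.comp continuous_fst).min continuous_const)
  refine Continuous.div ?_ (continuous_const.sub (continuous_const.mul h))
    fun p => (pushAmount_pos_denom p.2.2.2 p.1).ne'
  exact ((continuous_apply i).comp (continuous_subtype_val.comp continuous_fst)).sub h

lemma push_eq_self {s : unitInterval} {x : stdSimplex ℝ ι} (h : pushAmount s x = 0) :
    push s x = x := by
  ext i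
  rw [push_apply, h, mul_zero, sub_zero, sub_zero, div_one]

lemma push_zero (x : stdSimplex ℝ ι) : push 0 x = x :=
  push_eq_self (zero_mul _)

lemma push_of_minCoord_eq_zero (s : unitInterval) {x : stdSimplex ℝ ι} (h : minCoord x = 0) :
    push s x = x :=
  push_eq_self (by rw [pushAmount, h, min_eq_left collarWidth_pos.le, mul_zero])

/-- Equivalent to `card ι * minCoord x ≤ 1` when a positive amount is subtracted. It keeps the
collar stable throughout the deformation. -/
lemma minCoord_push_le (s : unitInterval) (x : stdSimplex ℝ ι) :
    minCoord (push s x) ≤ minCoord x := by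
  obtain ⟨i, hi⟩ := exists_minCoord_eq x
  refine (minCoord_le _ i).trans ?_
  rw [push_apply, ← hi, div_le_iff₀ (pushAmount_pos_denom s.2.2 x)]
  nlinarith [card_mul_minCoord_le x, pushAmount_nonneg s.2.1 x,
    mul_le_mul_of_nonneg_right (card_mul_minCoord_le x) (pushAmount_nonneg s.2.1 x)]

lemma minCoord_push_one {x : stdSimplex ℝ ι} (h : minCoord x ≤ collarWidth ι) :
    minCoord (push 1 x) = 0 := by
  obtain ⟨i, hi⟩ := exists_minCoord_eq x
  refine (minCoord_eq_zero_iff _).2 ⟨i, ?_⟩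
  have : pushAmount (1 : unitInterval) x = x i := by
    rw [pushAmount, min_eq_left h, hi]
    exact one_mul _
  rw [push_apply, this, sub_self, zero_div]

instance : ContractibleSpace {x : stdSimplex ℝ ι | 0 < minCoord x} := by
  let f : {x : stdSimplex ℝ ι | 0 < minCoord x} → (ι → ℝ) := fun x => x.1.1
  have hf : IsEmbedding f := IsEmbedding.subtypeVal.comp IsEmbedding.subtypeVal
  have hmem (v : ι → ℝ) : v ∈ Set.range f ↔ (∀ i, 0 < v i) ∧ ∑ i, v i = 1 := by
    constructor
    · rintro ⟨x, rfl⟩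
      exact ⟨fun i => lt_of_lt_of_le x.2 (minCoord_le x.1 i), x.1.2.2⟩
    · rintro ⟨h0, h1⟩
      exact ⟨⟨⟨v, fun i => (h0 i).le, h1⟩, (Finset.lt_inf'_iff _).2 fun i _ => h0 i⟩, rfl⟩
  have hconv : Convex ℝ (Set.range f) := by
    have : Set.range f = Set.univ.pi (fun _ => Set.Ioi 0) ∩ stdSimplex ℝ ι := by
      ext v
      rw [hmem]
      constructor
      · exact fun h => ⟨fun i _ => h.1 i, fun i => (h.1 i).le, h.2⟩
      · exact fun h => ⟨fun i => h.1 i trivial, h.2.2⟩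
    rw [this]
    exact (convex_pi fun i _ => convex_Ioi 0).inter (convex_stdSimplex ℝ ι)
  have hne : (Set.range f).Nonempty := by
    refine ⟨fun _ => (Fintype.card ι : ℝ)⁻¹, (hmem _).2 ⟨fun i => ?_, ?_⟩⟩
    · have : 0 < Fintype.card ι := Fintype.card_pos
      positivity
    · simp
  have := hconv.contractibleSpace hne
  exact hf.toHomeomorph.contractibleSpace

variable (ι) in
/-- The open collar of the boundary of a simplex, without the boundary. -/
def collar : Set (stdSimplex ℝ ι) := {x | 0 < minCoord x ∧ minCoord x < collarWidth ι}

end stdSimplex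

open stdSimplex

variable {Y Z ι : Type} [TopologicalSpace Y] [TopologicalSpace Z] [Fintype ι] [Nonempty ι]

/-- The space `Z` is obtained by attaching a cell, with characteristic map `b`, to the space `Y`. -/
structure CellAttachment (r : C(Y, Z)) (b : C(stdSimplex ℝ ι, Z)) : Prop where
  isQuotientMap : IsQuotientMap (Sum.elim r b)
  injective : Function.Injective r
  injOn : Set.InjOn b {x | 0 < minCoord x}
  mem_range_iff (x : stdSimplex ℝ ι) : b x ∈ Set.range r ↔ minCoord x = 0
  isClosed_preimage_image (C : Set Y) : IsClosed C → IsClosed (b ⁻¹' (r '' C))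

namespace CellAttachment

variable {r : C(Y, Z)} {b : C(stdSimplex ℝ ι, Z)} (h : CellAttachment r b)
include h

lemma isClosedEmbedding : IsClosedEmbedding r := by
  refine .of_continuous_injective_isClosedMap r.continuous h.injective fun C hC => ?_
  rw [← h.isQuotientMap.isClosed_preimage, isClosed_sum_iff]
  refine ⟨?_, h.isClosed_preimage_image C hC⟩
  rwa [← Set.preimage_comp, Sum.elim_comp_inl, Set.preimage_image_eq _ h.injective]

/-- Sets of interior points of the cell are saturated for the quotient map, so their images are open
as soon as they are. -/
lemma isOpenEmbedding {O : Set (stdSimplex ℝ ι)} (hO : IsOpen O) (hO' : ∀ x ∈ O, 0 < minCoord x) :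
    IsOpenEmbedding fun x : O => b x := by
  refine .of_continuous_injective_isOpenMap (by fun_prop)
    (fun x y hxy => Subtype.ext (h.injOn (hO' x x.2) (hO' y y.2) hxy)) fun O' hO'' => ?_
  rw [← h.isQuotientMap.isOpen_preimage, isOpen_sum_iff, ← Set.preimage_comp, ← Set.preimage_comp,
    Sum.elim_comp_inl, Sum.elim_comp_inr]
  constructor
  · convert isOpen_empty
    rw [Set.eq_empty_iff_forall_notMem]
    rintro y ⟨x, -, hx⟩
    exact (hO' x x.2).ne' ((h.mem_range_iff x).1 ⟨y, hx.symm⟩)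
  · convert hO.isOpenMap_subtype_val _ hO''
    ext x
    constructor
    · rintro ⟨x', hx', hx⟩
      have h0 : 0 < minCoord x := (minCoord_nonneg x).lt_of_ne' fun h0 =>
        (hO' x' x'.2).ne' ((h.mem_range_iff x').1
          ((show b x' = b x from hx) ▸ (h.mem_range_iff x).2 h0))
      exact ⟨x', hx', h.injOn (hO' x' x'.2) h0 hx⟩
    · rintro ⟨x', hx', rfl⟩
      exact ⟨x', hx', rfl⟩

lemma exists_lift {T : Type} [TopologicalSpace T] (f : C(Y, T)) (g : C(stdSimplex ℝ ι, T))
    (hfg : ∀ y x, b x = r y → g x = f y) :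
    ∃ l : C(Z, T), (∀ y, l (r y) = f y) ∧ ∀ x, l (b x) = g x := by
  let q : C(Y ⊕ stdSimplex ℝ ι, Z) := ⟨Sum.elim r b, by fun_prop⟩
  have hq : IsQuotientMap q := h.isQuotientMap
  have key (x y) (hxy : q x = q y) : Sum.elim f g x = Sum.elim f g y := by
    obtain x | x := x <;> obtain y | y := y
    · exact congrArg f (h.injective hxy)
    · exact (hfg _ _ hxy.symm).symm
    · exact hfg _ _ hxy
    · have hxy' : b x = b y := hxy
      by_cases hx : minCoord x = 0
      · obtain ⟨z, hz⟩ := (h.mem_range_iff x).2 hx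
        exact (hfg z x hz.symm).trans (hfg z y (hz.trans hxy').symm).symm
      · have hy : minCoord y ≠ 0 := fun hy =>
          hx ((h.mem_range_iff x).1 (hxy' ▸ (h.mem_range_iff y).2 hy))
        exact congrArg g (h.injOn ((minCoord_nonneg x).lt_of_ne' hx)
          ((minCoord_nonneg y).lt_of_ne' hy) hxy')
  let k : C(Y ⊕ stdSimplex ℝ ι, T) := ⟨Sum.elim f g, by fun_prop⟩
  let l := hq.lift k key
  have hl (p) : l (q p) = Sum.elim f g p := DFunLike.congr_fun (hq.lift_comp k key) p
  exact ⟨l, fun y => hl (.inl y), fun x => hl (.inr x)⟩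

lemma exists_height : ∃ μ : C(Z, ℝ), (∀ y, μ (r y) = 0) ∧ ∀ x, μ (b x) = minCoord x :=
  h.exists_lift 0 ⟨minCoord, continuous_minCoord⟩
    fun y x hxy => (h.mem_range_iff x).1 ⟨y, hxy.symm⟩

/-- The homotopy is descended in curried form, with values in a path space, which avoids multiplying
a quotient map by the interval. -/
lemma exists_deformation : ∃ G : C(Z, C(unitInterval, Z)), (∀ s y, G (r y) s = r y) ∧
    ∀ s x, G (b x) s = b (push s x) := by
  obtain ⟨G, hG, hG'⟩ := h.exists_lift (T := C(unitInterval, Z))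
    (⟨fun p : Y × unitInterval => r p.1, by fun_prop⟩ : C(Y × unitInterval, Z)).curry
    (⟨fun p : stdSimplex ℝ ι × unitInterval => b (push p.2 p.1),
      b.continuous.comp continuous_push⟩ :
      C(stdSimplex ℝ ι × unitInterval, Z)).curry (fun y x hxy => by
        ext s
        have := push_of_minCoord_eq_zero s ((h.mem_range_iff x).1 ⟨y, hxy.symm⟩)
        exact (congrArg b this).trans hxy)
  exact ⟨G, fun s y => DFunLike.congr_fun (hG y) s, fun s x => DFunLike.congr_fun (hG' x) s⟩

lemma surjective (z : Z) : (∃ y, r y = z) ∨ ∃ x, b x = z := by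
  obtain ⟨y | x, hp⟩ := h.isQuotientMap.surjective z
  exacts [.inl ⟨y, hp⟩, .inr ⟨x, hp⟩]

/-- The deformation preserves this neighbourhood and ends in the range of `r`, which is a copy of
`Y` because `r` is a closed embedding. -/
lemma nonempty_homotopyEquiv {μ : C(Z, ℝ)} (h0 : ∀ y, μ (r y) = 0)
    (h1 : ∀ x, μ (b x) = minCoord x) :
    Nonempty (ContinuousMap.HomotopyEquiv Y {z | μ z < collarWidth ι}) := by
  obtain ⟨G, hG, hG'⟩ := h.exists_deformation
  have hU (z) (hz : z ∈ {z | μ z < collarWidth ι}) (s) : G z s ∈ {z | μ z < collarWidth ι} := by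
    obtain ⟨y, rfl⟩ | ⟨x, rfl⟩ := h.surjective z
    · rwa [hG]
    · rw [hG', Set.mem_ofPred, h1]
      rw [Set.mem_ofPred, h1] at hz
      exact (minCoord_push_le s x).trans_lt hz
  have hr (z) (hz : z ∈ {z | μ z < collarWidth ι}) : G z 1 ∈ Set.range r := by
    obtain ⟨y, rfl⟩ | ⟨x, rfl⟩ := h.surjective z
    · exact ⟨y, (hG _ _).symm⟩
    · rw [Set.mem_ofPred, h1] at hz
      rw [hG', h.mem_range_iff]
      exact minCoord_push_one hz.le
  have hG0 (z) : G z 0 = z := by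
    obtain ⟨y, rfl⟩ | ⟨x, rfl⟩ := h.surjective z
    · rw [hG]
    · rw [hG', push_zero]
  let φ : Y ≃ₜ Set.range r := h.isClosedEmbedding.isEmbedding.toHomeomorph
  let i : C(Y, {z | μ z < collarWidth ι}) :=
    ⟨fun y => ⟨r y, (h0 y).trans_lt collarWidth_pos⟩, by fun_prop⟩
  let ρ : C({z | μ z < collarWidth ι}, Y) :=
    ⟨fun z => φ.symm ⟨G z 1, hr z z.2⟩, φ.symm.continuous.comp
      (Continuous.subtype_mk (by fun_prop) _)⟩
  have hρ (z) : r (ρ z) = G z 1 := congrArg Subtype.val (φ.apply_symm_apply ⟨G z 1, hr z z.2⟩)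
  refine ⟨i, ρ, ?_, ?_⟩
  · rw [show ρ.comp i = .id Y from ContinuousMap.ext fun y =>
      h.injective ((hρ _).trans (hG 1 y))]
  · refine ContinuousMap.Homotopic.symm ⟨⟨⟨fun p => ⟨G p.2 p.1, hU _ p.2.2 _⟩, ?_⟩, fun z => ?_,
      fun z => ?_⟩⟩
    · refine Continuous.subtype_mk ?_ _
      have : Continuous fun p : unitInterval × {z | μ z < collarWidth ι} => (G p.2.1, p.1) := by
        fun_prop
      exact ContinuousEval.continuous_eval.comp this
    · exact Subtype.ext (hG0 z)
    · exact Subtype.ext (hρ z).symm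

lemma exists_cover : ∃ U V : Set Z, IsOpen U ∧ IsOpen V ∧ U ∪ V = Set.univ ∧
    Nonempty (ContinuousMap.HomotopyEquiv Y U) ∧
    Nonempty ({x : stdSimplex ℝ ι | 0 < minCoord x} ≃ₜ V) ∧
    Nonempty (collar ι ≃ₜ (U ∩ V : Set Z)) := by
  obtain ⟨μ, h0, h1⟩ := h.exists_height
  have hpos : IsOpen {x : stdSimplex ℝ ι | 0 < minCoord x} :=
    isOpen_lt continuous_const continuous_minCoord
  have hcol : IsOpen (collar ι) := hpos.inter (isOpen_lt continuous_minCoord continuous_const)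
  have e := h.isOpenEmbedding hpos fun _ hx => hx
  have e' := h.isOpenEmbedding hcol fun _ hx => hx.1
  refine ⟨{z | μ z < collarWidth ι}, {z | 0 < μ z}, isOpen_lt (by fun_prop) continuous_const,
    isOpen_lt continuous_const (by fun_prop), ?_, h.nonempty_homotopyEquiv h0 h1,
    ⟨e.isEmbedding.toHomeomorph.trans (.setCongr ?_)⟩,
    ⟨e'.isEmbedding.toHomeomorph.trans (.setCongr ?_)⟩⟩
  · ext z
    have := collarWidth_pos (ι := ι)
    simp only [Set.mem_union, Set.mem_ofPred, Set.mem_univ, iff_true]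
    by_contra! h
    linarith
  · ext z
    constructor
    · rintro ⟨x, rfl⟩
      exact x.2.trans_eq (h1 x).symm
    · intro hz
      obtain ⟨y, rfl⟩ | ⟨x, rfl⟩ := h.surjective z
      · exact absurd (h0 y) (ne_of_gt hz)
      · exact ⟨⟨x, lt_of_lt_of_eq hz (h1 x)⟩, rfl⟩
  · ext z
    constructor
    · rintro ⟨x, rfl⟩
      exact ⟨(h1 x).trans_lt x.2.2, x.2.1.trans_eq (h1 x).symm⟩
    · intro hz
      obtain ⟨y, rfl⟩ | ⟨x, rfl⟩ := h.surjective z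
      · exact absurd (h0 y) (ne_of_gt hz.2)
      · exact ⟨⟨x, lt_of_lt_of_eq hz.2 (h1 x), (h1 x).symm.trans_lt hz.1⟩, rfl⟩

variable {R : Type} [CommRing R] [IsDomain R] [IsNoetherianRing R] {e w : ℤ}

lemma hasEulerData (he : HasEulerData R Y e) (hw : HasEulerData R (collar ι) w) :
    HasEulerData R Z (e + 1 - w) := by
  obtain ⟨U, V, hU, hV, hUV, ⟨f⟩, ⟨g⟩, ⟨k⟩⟩ := h.exists_cover
  exact HasEulerData.of_open_cover hU hV hUV (he.of_homotopyEquiv f)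
    (HasEulerData.of_contractible.of_homeomorph g) (hw.of_homeomorph k)

/-- The collar depends on `ι` only, so one attachment with `Y` and `Z` both known determines it for
all attachments of cells of that dimension. -/
lemma hasEulerData_collar (he : HasEulerData R Y e) (hw : HasEulerData R Z w) :
    HasEulerData R (collar ι) (e + 1 - w) := by
  obtain ⟨U, V, hU, hV, hUV, ⟨f⟩, ⟨g⟩, ⟨k⟩⟩ := h.exists_cover
  exact (HasEulerData.inter_of_open_cover hU hV hUV (he.of_homotopyEquiv f)
    (HasEulerData.of_contractible.of_homeomorph g) hw).of_homeomorph k.symm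

end CellAttachment

end

/-! ### Points of the geometric realization. -/

section

open CategoryTheory Limits Opposite Topology

namespace SSet

variable {X Y : SSet.{0}}

/-- The characteristic map of a simplex, from the topological simplex to the realization. -/
noncomputable def realize {n : ℕ} (x : Simplices X n) :
    C(_root_.stdSimplex ℝ (Fin (n + 1)), SSet.toTop.obj X) :=
  (SSet.toTop.map (yonedaEquiv.symm x)).hom.comp
    ⟨_, (SimplexCategory.toTopHomeo (.mk n)).symm.continuous⟩

lemma realize_apply {n : ℕ} (x : Simplices X n) (p : _root_.stdSimplex ℝ (Fin (n + 1))) :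
    realize x p = SSet.toTop.map (yonedaEquiv.symm x)
      ((SimplexCategory.toTopHomeo (.mk n)).symm p) := rfl

lemma toTop_map_realize (g : X ⟶ Y) {n : ℕ} (x : Simplices X n)
    (p : _root_.stdSimplex ℝ (Fin (n + 1))) :
    SSet.toTop.map g (realize x p) = realize (g.app _ x) p := by
  rw [realize_apply, realize_apply, ← yonedaEquiv_symm_comp, Functor.map_comp]
  rfl

lemma realize_map {m n : ℕ} (f : SimplexCategory.mk m ⟶ SimplexCategory.mk n) (x : Simplices X n)
    (p : _root_.stdSimplex ℝ (Fin (m + 1))) :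
    realize (X.map f.op x) p = realize x (_root_.stdSimplex.map f.toOrderHom p) := by
  rw [realize_apply, realize_apply, ← yonedaEquiv_symm_naturality_left, Functor.map_comp]
  have := SimplexCategory.toTopHomeo_symm_naturality_apply f p
  exact congrArg (SSet.toTop.map (yonedaEquiv.symm x)) this.symm

lemma toTop_hom_ext {T : TopCat.{0}} {f g : SSet.toTop.obj X ⟶ T}
    (h : ∀ (n : ℕ) (x : Simplices X n) p, f (realize x p) = g (realize x p)) : f = g := by
  apply (sSetTopAdj.homEquiv X T).injective
  have key (n : ℕ) (x : Simplices X n) :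
      yonedaEquiv.symm x ≫ sSetTopAdj.homEquiv X T f =
        yonedaEquiv.symm x ≫ sSetTopAdj.homEquiv X T g := by
    rw [← sSetTopAdj.homEquiv_naturality_left, ← sSetTopAdj.homEquiv_naturality_left]
    congr 1
    ext z
    obtain ⟨p, rfl⟩ := (SimplexCategory.toTopHomeo (.mk n)).symm.surjective z
    exact h n x p
  ext ⟨⟨n⟩⟩ x
  have := key n x
  rw [yonedaEquiv_symm_comp, yonedaEquiv_symm_comp] at this
  exact yonedaEquiv.symm.injective this

/-- Every map into `Prop` with the indiscrete topology is continuous, so `toTop_hom_ext` identifies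
the predicate of being a realized point with `True`. -/
lemma exists_realize (z : SSet.toTop.obj X) :
    ∃ (n : ℕ) (x : Simplices X n) (p : _), realize x p = z := by
  let T : TopCat.{0} := @TopCat.of Prop ⊤
  let f : SSet.toTop.obj X ⟶ T := @TopCat.ofHom _ _ _ ⊤ (@ContinuousMap.mk _ _ _ ⊤
    (fun z => ∃ (n : ℕ) (x : Simplices X n) (p : _), realize x p = z) continuous_top)
  let g : SSet.toTop.obj X ⟶ T := @TopCat.ofHom _ _ _ ⊤ (@ContinuousMap.mk _ _ _ ⊤
    (fun z => True) continuous_top)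
  have : f = g := toTop_hom_ext fun n x p => eq_true ⟨n, x, p, rfl⟩
  exact of_eq_true (ConcreteCategory.congr_hom this z)

end SSet

end

/-! ### The realization of the boundary of a simplex. -/

section

open CategoryTheory Limits Opposite Topology

namespace stdSimplex

variable {ι κ : Type} [Fintype ι] [Fintype κ]

lemma map_apply_ne_zero_iff (f : κ → ι) (x : stdSimplex ℝ κ) (i : ι) :
    map f x i ≠ 0 ↔ ∃ j, f j = i ∧ x j ≠ 0 := by
  classical
  rw [map_coe, FunOnFinite.linearMap_apply_apply]
  refine (not_congr (Finset.sum_eq_zero_iff_of_nonneg fun j _ => x.2.1 j)).trans ?_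
  simp
  rfl

lemma map_apply_of_injective {f : κ → ι} (hf : Function.Injective f) (x : stdSimplex ℝ κ) (j : κ) :
    map f x (f j) = x j := by
  classical
  rw [map_coe, FunOnFinite.linearMap_apply_apply, Finset.sum_eq_single_of_mem j (by simp)]
  intro k hk hkj
  simp only [Finset.mem_filter, Finset.mem_univ, true_and] at hk
  exact absurd (hf hk) hkj

lemma map_injective {f : κ → ι} (hf : Function.Injective f) :
    Function.Injective (map f : stdSimplex ℝ κ → stdSimplex ℝ ι) := fun x y h => by
  ext j
  rw [← map_apply_of_injective hf x, ← map_apply_of_injective hf y, h]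

lemma exists_map_eq {f : κ → ι} (hf : Function.Injective f) {z : stdSimplex ℝ ι}
    (hz : ∀ i, z i ≠ 0 → i ∈ Set.range f) : ∃ x, map f x = z := by
  classical
  have hsum : ∑ j, z (f j) = 1 := by
    rw [← (z.2.2 : ∑ i, z i = 1), ← Finset.sum_image (s := Finset.univ) (f := fun i => z i)
      (g := f) hf.injOn]
    refine Finset.sum_subset (Finset.subset_univ _) fun i _ hi => ?_
    by_contra h
    obtain ⟨j, hj⟩ := hz i h
    exact hi (Finset.mem_image.2 ⟨j, Finset.mem_univ _, hj⟩)
  let x : stdSimplex ℝ κ := ⟨fun j => z (f j), fun j => z.2.1 _, hsum⟩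
  refine ⟨x, ?_⟩
  ext i
  by_cases hi : i ∈ Set.range f
  · obtain ⟨j, rfl⟩ := hi
    exact map_apply_of_injective hf x j
  · have h1 : z i = 0 := by_contra fun h => hi (hz i h)
    rw [h1]
    by_contra h
    obtain ⟨j, hj, -⟩ := (map_apply_ne_zero_iff f x i).1 h
    exact hi ⟨j, hj⟩

/-- The set of vertices of the smallest face containing a point. -/
noncomputable def support (z : stdSimplex ℝ ι) : Finset ι := by
  classical exact Finset.univ.filter fun i => z i ≠ 0

lemma mem_support {z : stdSimplex ℝ ι} {i : ι} : i ∈ support z ↔ z i ≠ 0 := by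
  simp [support]

lemma exists_support_card (z : stdSimplex ℝ ι) : ∃ k, (support z).card = k + 1 := by
  refine Nat.exists_eq_add_one.2 (Finset.card_pos.2 ?_)
  by_contra! h
  have : ∑ i, z i = 0 := Finset.sum_eq_zero fun i _ => by
    by_contra hi
    exact Finset.notMem_empty i (h ▸ mem_support.2 hi)
  exact zero_ne_one (this.symm.trans z.2.2)

end stdSimplex

namespace SSet

lemma toTopHomeo_realize {n k : ℕ} (s : Simplices (stdSimplex.obj (.mk n)) k)
    (p : _root_.stdSimplex ℝ (Fin (k + 1))) :
    SimplexCategory.toTopHomeo (.mk n) (realize s p) =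
      _root_.stdSimplex.map (stdSimplex.asOrderHom s) p := by
  have h : yonedaEquiv.symm s = SSet.stdSimplex.map (SSet.stdSimplex.objEquiv s) := rfl
  rw [realize_apply, h, SimplexCategory.toTopHomeo_naturality_apply, Homeomorph.apply_symm_apply]
  rfl

/-- The support of `z` spans the unique face having `z` in its interior, and `w` is the point of
that face. Any other representative of `z` reduces to it, so this gives both the image and the
injectivity of the realized inclusion. -/
lemma exists_realize_boundary {n : ℕ} (z : _root_.stdSimplex ℝ (Fin (n + 1))) (hz : ∃ i, z i = 0) :
    ∃ w : SSet.toTop.obj (boundary n : SSet.{0}),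
      SimplexCategory.toTopHomeo (.mk n) (SSet.toTop.map (boundary n).ι w) = z ∧
      ∀ (k : ℕ) (s : Simplices (boundary n) k) (p : _root_.stdSimplex ℝ (Fin (k + 1))),
        _root_.stdSimplex.map (stdSimplex.asOrderHom s.1) p = z → realize s p = w := by
  obtain ⟨j, hj⟩ := stdSimplex.exists_support_card z
  let e : Fin (j + 1) ↪o Fin (n + 1) := (stdSimplex.support z).orderEmbOfFin hj
  have he (i) : i ∈ Set.range e ↔ z i ≠ 0 := by
    rw [Finset.range_orderEmbOfFin]
    exact stdSimplex.mem_support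
  obtain ⟨z', hz'⟩ := stdSimplex.exists_map_eq e.injective fun i hi => (he i).2 hi
  let y : Simplices (boundary.{0} n) j := ⟨stdSimplex.objMk e.toOrderHom, fun h => by
    obtain ⟨i, hi⟩ := hz
    exact (he i).1 (h i) hi⟩
  refine ⟨realize y z', ?_, fun k s p hp => ?_⟩
  · rw [toTop_map_realize, toTopHomeo_realize]
    exact hz'
  · obtain ⟨l, hl⟩ := stdSimplex.exists_support_card p
    let a : Fin (l + 1) ↪o Fin (k + 1) := (stdSimplex.support p).orderEmbOfFin hl
    have ha (i) : i ∈ Set.range a ↔ p i ≠ 0 := by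
      rw [Finset.range_orderEmbOfFin]
      exact stdSimplex.mem_support
    obtain ⟨p', hp'⟩ := stdSimplex.exists_map_eq a.injective fun i hi => (ha i).2 hi
    have hmem (i : Fin (l + 1)) : stdSimplex.asOrderHom s.1 (a i) ∈ stdSimplex.support z := by
      rw [stdSimplex.mem_support, ← hp, stdSimplex.map_apply_ne_zero_iff]
      exact ⟨a i, rfl, (ha _).1 ⟨i, rfl⟩⟩
    let o := (stdSimplex.support z).orderIsoOfFin hj
    let c : Fin (l + 1) →o Fin (j + 1) :=
      ⟨fun i => o.symm ⟨stdSimplex.asOrderHom s.1 (a i), hmem i⟩, fun i i' hi =>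
        o.symm.monotone ((stdSimplex.asOrderHom s.1).monotone (a.monotone hi))⟩
    have hc (i) : e (c i) = stdSimplex.asOrderHom s.1 (a i) :=
      congrArg Subtype.val (o.apply_symm_apply ⟨_, hmem i⟩)
    -- Restricted to the support of `p`, the simplex `s` has all its vertices in the support of `z`
    -- and thus factors through the face `y`.
    have hfac : (boundary.{0} n : SSet.{0}).map (SimplexCategory.mkHom a.toOrderHom).op s =
        (boundary.{0} n : SSet.{0}).map (SimplexCategory.mkHom c).op y := by
      refine Subtype.ext (stdSimplex.objEquiv.injective ?_)
      ext i
      exact congrArg Fin.val (hc i).symm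
    have h1 : realize s p = realize y (_root_.stdSimplex.map c p') := by
      rw [← hp']
      refine (realize_map (SimplexCategory.mkHom a.toOrderHom) s p').symm.trans ?_
      exact (congrArg (fun t => realize t p') hfac).trans (realize_map _ _ _)
    rw [h1]
    refine congrArg (realize y) (stdSimplex.map_injective e.injective ?_)
    rw [hz', ← hp, ← hp', stdSimplex.map_comp_apply, stdSimplex.map_comp_apply]
    exact congrArg (fun f => _root_.stdSimplex.map f p') (funext hc)

variable {n : ℕ}

lemma toTopHomeo_boundary_realize {k : ℕ} (s : Simplices (boundary.{0} n) k)
    (p : _root_.stdSimplex ℝ (Fin (k + 1))) :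
    SimplexCategory.toTopHomeo (.mk n) (SSet.toTop.map (boundary.{0} n).ι (realize s p)) =
      _root_.stdSimplex.map (stdSimplex.asOrderHom s.1) p := by
  rw [toTop_map_realize, toTopHomeo_realize]
  rfl

lemma exists_toTopHomeo_boundary_eq_zero (w : SSet.toTop.obj (boundary n : SSet.{0})) :
    ∃ i, SimplexCategory.toTopHomeo (.mk n) (SSet.toTop.map (boundary.{0} n).ι w) i = 0 := by
  obtain ⟨k, s, p, rfl⟩ := exists_realize w
  obtain ⟨i, hi⟩ := not_forall.1 s.2
  refine ⟨i, ?_⟩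
  rw [toTopHomeo_boundary_realize]
  by_contra h
  obtain ⟨j, hj, -⟩ := (stdSimplex.map_apply_ne_zero_iff _ _ _).1 h
  exact hi ⟨j, hj⟩

lemma toTop_map_boundary_ι_injective :
    Function.Injective (SSet.toTop.map (boundary.{0} n).ι) := by
  intro w w' h
  obtain ⟨k, s, p, rfl⟩ := exists_realize w
  obtain ⟨k', s', p', rfl⟩ := exists_realize w'
  obtain ⟨w, -, hw⟩ := exists_realize_boundary _ (exists_toTopHomeo_boundary_eq_zero (realize s p))
  rw [hw k s p (toTopHomeo_boundary_realize s p).symm, hw k' s' p']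
  rw [h, toTopHomeo_boundary_realize]

lemma range_toTopHomeo_boundary :
    Set.range (fun w => SimplexCategory.toTopHomeo (.mk n) (SSet.toTop.map (boundary.{0} n).ι w)) =
      {z : _root_.stdSimplex ℝ (Fin (n + 1)) | stdSimplex.minCoord z = 0} := by
  ext z
  constructor
  · rintro ⟨w, rfl⟩
    exact (stdSimplex.minCoord_eq_zero_iff _).2 (exists_toTopHomeo_boundary_eq_zero w)
  · intro hz
    obtain ⟨w, hw, -⟩ := exists_realize_boundary z ((stdSimplex.minCoord_eq_zero_iff _).1 hz)
    exact ⟨w, hw⟩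

end SSet

end

/-! ### Removing a nondegenerate simplex: the pushout of simplicial sets. -/

section

open CategoryTheory Limits Opposite Topology

namespace SSet

/-- For `boundary d` this makes the realized inclusion into the simplex a closed map. -/
instance {X : SSet.{0}} [X.Finite] : CompactSpace (SSet.toTop.obj X) where
  isCompact_univ := by
    have : (Set.univ : Set (SSet.toTop.obj X)) = ⋃ s : X.N, Set.range (realize s.simplex) := by
      symm
      rw [Set.eq_univ_iff_forall]
      intro z
      obtain ⟨n, x, p, rfl⟩ := exists_realize z
      obtain ⟨m, f, -, y, rfl⟩ := X.exists_nonDegenerate x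
      exact Set.mem_iUnion.2 ⟨N.mk y.1 y.2, _, (realize_map f y.1 p).symm⟩
    rw [this]
    exact isCompact_iUnion fun s => isCompact_range (realize s.simplex).continuous

instance (n : ℕ) : (boundary.{0} n : SSet.{0}).Finite := inferInstance

section Attach

variable {S : SSet.{0}} {d : ℕ} {x : Simplices S d} {A : S.Subcomplex}

/-- The subcomplex `A` of `S` contains all the simplices, except those having the nondegenerate
simplex `x` as a face. -/
structure IsCellComplement (A : S.Subcomplex) {d : ℕ} (x : Simplices S d) : Prop where
  nonDegenerate : x ∈ S.nonDegenerate d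
  notMem : x ∉ A.obj (op (.mk d))
  mem_of_lt {k : ℕ} (hk : k < d) (y : Simplices S k) : y ∈ A.obj (op (.mk k))
  mem_or {n : SimplexCategoryᵒᵖ} (y : S.obj n) :
    y ∈ A.obj n ∨ ∃ f : n.unop ⟶ SimplexCategory.mk d, S.map f.op x = y

namespace IsCellComplement

variable (h : IsCellComplement A x)
include h

/-- Nondegenerate simplices of the boundary have dimension less than `d`, so they land in `A`; the
whole simplex does not, since `x` is not in `A`. -/
lemma preimage_eq : A.preimage (yonedaEquiv.symm x) = boundary d := by
  rw [stdSimplex.eq_boundary_iff]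
  refine ⟨?_, fun h' ↦ h.notMem ?_⟩
  · rw [Subcomplex.le_iff_contains_nonDegenerate]
    rintro n ⟨y, hy₁⟩ hy₂
    have : n < d := dim_lt_of_nonDegenerate (X := boundary d)
      ⟨⟨y, hy₂⟩, ((boundary d).mem_nonDegenerate_iff ⟨y, hy₂⟩).2 hy₁⟩ d
    exact h.mem_of_lt this _
  · have := h'.symm.le _ (show stdSimplex.objEquiv.symm (𝟙 (SimplexCategory.mk d)) ∈ _ from trivial)
    simpa using this

omit h in
/-- The attaching map of the missing cell. -/
def attach (h : IsCellComplement A x) : (boundary.{0} d : SSet.{0}) ⟶ A :=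
  Subcomplex.lift ((boundary d).ι ≫ yonedaEquiv.symm x) (by
    rintro n _ ⟨s, rfl⟩
    exact h.preimage_eq.ge _ s.2)

/-- Degreewise, the simplices outside the boundary are the surjections onto `[d]`. Distinct ones
give distinct degeneracies of `x`, by uniqueness of the nondegenerate representative. -/
lemma isPushout : IsPushout h.attach (boundary d).ι A.ι (yonedaEquiv.symm x) where
  w := rfl
  isColimit' := ⟨evaluationJointlyReflectsColimits _ (fun ⟨⟨n⟩⟩ ↦ by
    refine (isColimitMapCoconePushoutCoconeEquiv _ _).2
      (IsPushout.isColimit ?_)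
    refine Types.isPushout_of_isPullback_of_mono' ?_ ?_ ?_
    · rw [Types.isPullback_iff]
      refine ⟨rfl, fun y y' ⟨_, hy⟩ => Subtype.ext hy, fun ⟨y, hy⟩ s hs => ?_⟩
      have hs' : (yonedaEquiv.symm x).app _ s ∈ A.obj _ := by
        have : y = (yonedaEquiv.symm x).app _ s := hs
        exact this ▸ hy
      exact ⟨⟨s, h.preimage_eq.le _ hs'⟩, Subtype.ext hs.symm, rfl⟩
    · refine Set.eq_univ_of_forall fun y => ?_
      obtain hy | ⟨f, rfl⟩ := h.mem_or y
      · exact Or.inl ⟨⟨y, hy⟩, rfl⟩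
      · exact Or.inr ⟨stdSimplex.objEquiv.symm f, rfl⟩
    · intro s s' hs hs' hss
      have epi (t : (SSet.stdSimplex.obj (.mk d)).obj (op (.mk n)))
          (ht : t ∉ Set.range ((boundary.{0} d).ι.app (op (.mk n)))) :
          Epi (SSet.stdSimplex.objEquiv t) := by
        rw [SimplexCategory.epi_iff_surjective]
        exact not_not.1 fun h' => ht ⟨⟨t, h'⟩, rfl⟩
      have := epi s hs
      have := epi s' hs'
      refine stdSimplex.objEquiv.injective ?_
      exact S.unique_nonDegenerate_map _ (stdSimplex.objEquiv s) ⟨x, h.nonDegenerate⟩ rfl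
        (stdSimplex.objEquiv s') ⟨x, h.nonDegenerate⟩ hss)⟩

end IsCellComplement

end Attach

end SSet

end

/-! ### From pushouts of spaces to cell attachments. -/

section

open CategoryTheory Limits Opposite Topology

namespace TopCat.IsPushout

variable {X₁ X₂ X₃ X₄ : TopCat.{0}} {t : X₁ ⟶ X₂} {l : X₁ ⟶ X₃} {r : X₂ ⟶ X₄} {b : X₃ ⟶ X₄}
  (h : IsPushout t l r b)
include h

lemma isPushout_forget : IsPushout ((forget TopCat).map t) ((forget TopCat).map l)
    ((forget TopCat).map r) ((forget TopCat).map b) := h.map (forget TopCat)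

lemma injective (hl : Function.Injective l) : Function.Injective r :=
  Types.pushoutCocone_inr_injective_of_isColimit (isPushout_forget h).flip.isColimit hl

lemma exists_of_eq (hl : Function.Injective l) {y : X₂} {p : X₃} (hyp : r y = b p) :
    ∃ w, t w = y ∧ l w = p := by
  have := Types.isPullback_of_isPushout (isPushout_forget h).flip hl
  obtain ⟨w, hw, hw'⟩ := ((Types.isPullback_iff _ _ _ _).1 this).2.2 p y hyp.symm
  exact ⟨w, hw', hw⟩

lemma surjective (z : X₄) : (∃ y, r y = z) ∨ ∃ p, b p = z :=
  Types.eq_or_eq_of_isPushout (isPushout_forget h) z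

/-- Predicates on the components which agree descend to the pushout. -/
lemma exists_predicate (P : X₂ → Prop) (Q : X₃ → Prop) (hPQ : ∀ w, P (t w) ↔ Q (l w)) :
    ∃ F : X₄ → Prop, (∀ y, F (r y) ↔ P y) ∧ ∀ p, F (b p) ↔ Q p := by
  obtain ⟨F, hF, hF'⟩ := (isPushout_forget h).exists_desc (W := Prop) (↾P) (↾Q)
    (by ext w; exact hPQ w)
  exact ⟨F, fun y => (ConcreteCategory.congr_hom hF y).to_iff,
    fun p => (ConcreteCategory.congr_hom hF' p).to_iff⟩

/-- The predicate "equal to `p`" on `X₃` agrees with `False` on `X₂` over `X₁`, so it descends and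
separates `p` from every other point. -/
lemma eq_of_eq {p q : X₃} (hp : p ∉ Set.range l) (hpq : b p = b q) : p = q := by
  obtain ⟨F, -, hF⟩ := exists_predicate h (fun _ => False) (fun q => p = q)
    fun w => ⟨False.elim, fun hw => hp ⟨w, hw.symm⟩⟩
  exact (hF q).1 (hpq ▸ (hF p).2 rfl)

lemma isQuotientMap : IsQuotientMap (Sum.elim r b) := by
  refine (isQuotientMap_iff _).2 ⟨isCoinducing_iff.2 fun O => ?_, fun z => ?_⟩
  swap
  · obtain ⟨y, hy⟩ | ⟨p, hp⟩ := surjective h z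
    exacts [⟨.inl y, hy⟩, ⟨.inr p, hp⟩]
  · rw [isOpen_sum_iff, ← Set.preimage_comp, ← Set.preimage_comp, Sum.elim_comp_inl,
      Sum.elim_comp_inr]
    refine ⟨fun ⟨hr, hb⟩ => ?_,
      fun hO => ⟨hO.preimage r.hom.continuous, hO.preimage b.hom.continuous⟩⟩
    refine (TopCat.isOpen_iff_of_isColimit _ h.isColimit O).2 fun j => ?_
    obtain _ | _ | _ := j
    · have e : h.cocone.ι.app WalkingSpan.zero = t ≫ r := PushoutCocone.condition_zero _
      change IsOpen (h.cocone.ι.app WalkingSpan.zero ⁻¹' O)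
      rw [e]
      exact hr.preimage t.hom.continuous
    · exact hr
    · exact hb

end TopCat.IsPushout

namespace SSet.IsCellComplement

variable {S : SSet.{0}} {d : ℕ} {x : Simplices S d} {A : S.Subcomplex} (h : IsCellComplement A x)
include h

/-- The realization of a simplicial set is obtained by attaching a cell to the realization of the
complement of a top dimensional cell. -/
lemma cellAttachment : CellAttachment (SSet.toTop.map A.ι).hom (realize x) := by
  have hp := h.isPushout.map SSet.toTop
  have hl := toTop_map_boundary_ι_injective (n := d)
  let φ := SimplexCategory.toTopHomeo (.mk d)
  have hmem (z : _root_.stdSimplex ℝ (Fin (d + 1))) :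
      (∃ w, SSet.toTop.map (boundary.{0} d).ι w = φ.symm z) ↔ stdSimplex.minCoord z = 0 := by
    refine Iff.trans ?_ (Set.ext_iff.1 (range_toTopHomeo_boundary (n := d)) z)
    exact exists_congr fun w => φ.eq_symm_apply
  refine
    { isQuotientMap := ?_
      injective := TopCat.IsPushout.injective hp hl
      injOn := fun z hz z' _ hzz => φ.symm.injective
        (TopCat.IsPushout.eq_of_eq hp (fun hw => hz.ne' ((hmem z).1 hw)) hzz)
      mem_range_iff := fun z => ?_
      isClosed_preimage_image := fun C hC => ?_ }
  · convert (TopCat.IsPushout.isQuotientMap hp).comp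
      ((Homeomorph.refl (SSet.toTop.obj A)).sumCongr φ.symm).isQuotientMap using 1
    funext z
    obtain z | z := z <;> rfl
  · rw [← hmem]
    constructor
    · rintro ⟨y, hy⟩
      obtain ⟨w, -, hw⟩ := TopCat.IsPushout.exists_of_eq hp hl hy
      exact ⟨w, hw⟩
    · rintro ⟨w, hw⟩
      refine ⟨SSet.toTop.map h.attach w, (ConcreteCategory.congr_hom hp.w w).trans ?_⟩
      exact congrArg (SSet.toTop.map (yonedaEquiv.symm x)) hw
  -- The set in question is the image under `c` of a closed set, and `c` is closed, being continuous
  -- from a compact to a Hausdorff space.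
  · let c : SSet.toTop.obj (boundary.{0} d : SSet.{0}) → _root_.stdSimplex ℝ (Fin (d + 1)) :=
      fun w => φ (SSet.toTop.map (boundary.{0} d).ι w)
    have hc : Continuous c := φ.continuous.comp (SSet.toTop.map (boundary.{0} d).ι).hom.continuous
    convert hc.isClosedMap _ (hC.preimage (SSet.toTop.map h.attach).hom.continuous) using 1
    ext z
    constructor
    · rintro ⟨y, hy, hyz⟩
      obtain ⟨w, rfl, hw⟩ := TopCat.IsPushout.exists_of_eq hp hl hyz
      exact ⟨w, hy, φ.eq_symm_apply.1 hw⟩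
    · rintro ⟨w, hw, rfl⟩
      refine ⟨_, hw, (ConcreteCategory.congr_hom hp.w w).trans ?_⟩
      exact congrArg (SSet.toTop.map (yonedaEquiv.symm x)) (φ.symm_apply_apply _).symm

end SSet.IsCellComplement

end

/-! ### Counting simplices and the induction over cells. -/

section

open CategoryTheory Limits Opposite Topology

namespace SSet

section Complement

variable {S : SSet.{0}} {d : ℕ}

/-- The subcomplex of the simplices which do not have `x` as a face. -/
def complement (x : Simplices S d) : S.Subcomplex where
  obj n := {y | ¬ ∃ f : SimplexCategory.mk d ⟶ n.unop, S.map f.op y = x}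
  map g y hy := fun ⟨f, hf⟩ => hy ⟨f ≫ g.unop, by
    rw [← hf, op_comp, Functor.map_comp]
    rfl⟩

/-- A nondegenerate `x` can be a face of `z` only along a monomorphism. If `z` is nondegenerate as
well, the dimension bound forces that map to be the identity, so all missing simplices come from
`x`. -/
lemma isCellComplement_complement [S.HasDimensionLT (d + 1)] {x : Simplices S d}
    (hx : x ∈ S.nonDegenerate d) : IsCellComplement (complement x) x where
  nonDegenerate := hx
  notMem h := h ⟨𝟙 _, by simp⟩
  mem_of_lt {k} hk y := fun ⟨f, hf⟩ => by
    have := S.mono_of_nonDegenerate ⟨x, hx⟩ f y hf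
    exact absurd (SimplexCategory.len_le_of_mono f) (not_le.2 hk)
  mem_or {n} y := by
    obtain ⟨m, g, -, z, rfl⟩ := S.exists_nonDegenerate (n := n.unop.len) y
    by_cases hz : z.1 ∈ (complement x).obj (op (.mk m))
    · exact .inl ((complement x).map g.op hz)
    · obtain ⟨f, hf⟩ := not_not.1 hz
      have := S.mono_of_nonDegenerate ⟨x, hx⟩ f z.1 hf
      have h1 : d ≤ m := SimplexCategory.len_le_of_mono f
      obtain rfl : m = d := le_antisymm (S.dim_le_of_nonDegenerate z d) h1
      obtain rfl := SimplexCategory.eq_id_of_mono f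
      refine .inr ⟨g, ?_⟩
      rw [← hf]
      simp

lemma isCellComplement_boundary (d : ℕ) : IsCellComplement (boundary.{0} d)
    (SSet.stdSimplex.objEquiv.symm (𝟙 (SimplexCategory.mk d))) where
  nonDegenerate := (stdSimplex.objEquiv_symm_mem_nonDegenerate_iff_mono _).2 inferInstance
  notMem := stdSimplex.notMem_boundary d
  mem_of_lt {k} hk y := by
    rw [boundary_obj_eq_univ k d hk]
    trivial
  mem_or y := .inr ⟨stdSimplex.objEquiv y,
    (stdSimplex.map_objEquiv_symm _ _).trans ((congrArg stdSimplex.objEquiv.symm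
      (Category.comp_id _)).trans (stdSimplex.objEquiv.symm_apply_apply y))⟩

end Complement

section Count

/-- The alternating sum of the numbers of nondegenerate simplices of dimension less than `D`. -/
noncomputable def eulerSum (S : SSet.{0}) (D : ℕ) : ℤ :=
  ∑ k ∈ Finset.range D, (-1) ^ k * (Nat.card (S.nonDegenerate k) : ℤ)

variable {S : SSet.{0}} {d : ℕ} {x : Simplices S d} {A : S.Subcomplex}

namespace IsCellComplement

variable (h : IsCellComplement A x)
include h

lemma card_nonDegenerate_of_lt {k : ℕ} (hk : k < d) :
    Nat.card ((A : SSet.{0}).nonDegenerate k) = Nat.card (S.nonDegenerate k) :=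
  Nat.card_congr
    { toFun y := ⟨y.1.1, (A.mem_nonDegenerate_iff y.1).1 y.2⟩
      invFun y := ⟨⟨y.1, h.mem_of_lt hk y.1⟩, (A.mem_nonDegenerate_iff _).2 y.2⟩
      left_inv _ := rfl
      right_inv _ := rfl }

lemma eulerSum_eq : eulerSum A d = eulerSum S d :=
  Finset.sum_congr rfl fun k hk => by
    rw [h.card_nonDegenerate_of_lt (Finset.mem_range.1 hk)]

lemma card_nonDegenerate [S.Finite] :
    Nat.card (S.nonDegenerate d) = Nat.card ((A : SSet.{0}).nonDegenerate d) + 1 := by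
  let f : Option ((A : SSet.{0}).nonDegenerate d) → S.nonDegenerate d :=
    fun o => o.elim ⟨x, h.nonDegenerate⟩ fun y => ⟨y.1.1, (A.mem_nonDegenerate_iff y.1).1 y.2⟩
  have hf : Function.Bijective f := by
    constructor
    · rintro (_ | y) (_ | y') hy
      · rfl
      · have hy' : x = y'.1.1 := congrArg Subtype.val hy
        exact absurd (hy' ▸ y'.1.2) h.notMem
      · have hy' : y.1.1 = x := congrArg Subtype.val hy
        exact absurd (hy' ▸ y.1.2) h.notMem
      · have hy' : y.1.1 = y'.1.1 := congrArg (Subtype.val (p := (· ∈ S.nonDegenerate d))) hy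
        exact congrArg some (Subtype.ext (Subtype.ext hy'))
    · rintro ⟨y, hy⟩
      obtain hA | ⟨g, rfl⟩ := h.mem_or y
      · exact ⟨some ⟨⟨y, hA⟩, (A.mem_nonDegenerate_iff _).2 hy⟩, rfl⟩
      · have := S.mono_of_nonDegenerate ⟨_, hy⟩ g x rfl
        obtain rfl := SimplexCategory.eq_id_of_mono g
        exact ⟨none, Subtype.ext (by simp [f])⟩
  rw [← Nat.card_eq_of_bijective f hf, Finite.card_option]

end IsCellComplement

lemma card_nonDegenerate_stdSimplex (n k : ℕ) :
    Nat.card ((SSet.stdSimplex.{0}.obj (.mk n)).nonDegenerate k) = (n + 1).choose (k + 1) := by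
  rw [Nat.card_congr stdSimplex.nonDegenerateEquiv', Nat.card_eq_fintype_card]
  exact (Fintype.card_finset_len (α := Fin (n + 1)) (k + 1)).trans (by rw [Fintype.card_fin])

/-- The full alternating sum of the binomial coefficients of `n + 1` vanishes. Omitted here are the
terms of the empty face and of the top simplex, so this is the sum for the boundary. -/
lemma eulerSum_stdSimplex (n : ℕ) :
    eulerSum (SSet.stdSimplex.obj (.mk n)) n = 1 - (-1) ^ n := by
  have h := Int.alternating_sum_range_choose_of_ne (Nat.succ_ne_zero n)
  rw [Finset.sum_range_succ', Finset.sum_range_succ] at h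
  simp only [eulerSum, card_nonDegenerate_stdSimplex]
  simp only [Nat.succ_eq_add_one, pow_succ, mul_neg_one, neg_mul, Finset.sum_neg_distrib,
    Nat.choose_self, Nat.choose_zero_right] at h
  push_cast at h
  linarith

end Count

section Euler

variable {R : Type} [CommRing R] [IsDomain R] [IsNoetherianRing R]

lemma isEmpty_toTop (S : SSet.{0}) [S.HasDimensionLT 0] : IsEmpty (SSet.toTop.obj S) := by
  refine ⟨fun z => ?_⟩
  obtain ⟨n, x, -, -⟩ := exists_realize z
  obtain ⟨m, -, -, y, -⟩ := S.exists_nonDegenerate x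
  exact absurd (S.dim_lt_of_nonDegenerate y 0) (Nat.not_lt_zero m)

/-- The Euler characteristic of the realization of a finite simplicial set. -/
theorem hasEulerData_toTop (D : ℕ) (S : SSet.{0}) [S.Finite] [S.HasDimensionLT D] :
    HasEulerData R (SSet.toTop.obj S) (eulerSum S D) := by
  induction D generalizing S with
  | zero =>
    have := isEmpty_toTop S
    exact HasEulerData.of_isEmpty
  | succ D ih =>
    -- Computed from the attachment of `Δ^D` to its boundary: the simplex has value `1`, so the
    -- collar has the value of the boundary.
    have hcollar : HasEulerData R (stdSimplex.collar (Fin (D + 1))) (1 - (-1) ^ D) := by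
      have h1 := ih (boundary.{0} D)
      rw [(isCellComplement_boundary D).eulerSum_eq, eulerSum_stdSimplex] at h1
      have h2 : HasEulerData R (SSet.toTop.obj (SSet.stdSimplex.{0}.obj (.mk D))) 1 := by
        have : ContractibleSpace (_root_.stdSimplex ℝ (Fin (D + 1))) :=
          (convex_stdSimplex ℝ _).contractibleSpace ⟨_, (stdSimplex.vertex (S := ℝ) 0).2⟩
        have : ContractibleSpace (SSet.toTop.obj (SSet.stdSimplex.{0}.obj (.mk D))) :=
          (SimplexCategory.toTopHomeo (.mk D)).contractibleSpace
        exact HasEulerData.of_contractible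
      have h3 := (isCellComplement_boundary D).cellAttachment.hasEulerData_collar h1 h2
      rwa [add_sub_cancel_right] at h3
    -- Inner induction on the number of top simplices. Each one adds `1 - (1 - (-1) ^ D) = (-1) ^
    -- D`.
    obtain ⟨c, hc⟩ : ∃ c, c = Nat.card (S.nonDegenerate D) := ⟨_, rfl⟩
    induction c generalizing S with
    | zero =>
      have hS : S.HasDimensionLT D := by
        refine ⟨fun n hn => ?_⟩
        obtain rfl | hn := hn.eq_or_lt
        · have : IsEmpty (S.nonDegenerate D) := Finite.card_eq_zero_iff.1 hc.symm
          exact Set.eq_univ_of_forall fun y => not_not.1 fun hy => isEmptyElim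
            (⟨y, hy⟩ : S.nonDegenerate D)
        · exact S.degenerate_eq_univ_of_hasDimensionLT (D + 1) n hn
      have := ih S
      rwa [eulerSum, Finset.sum_range_succ, ← hc, Nat.cast_zero, mul_zero, add_zero]
    | succ c ihc =>
      have : Nonempty (S.nonDegenerate D) := (Nat.card_pos_iff.1 (by omega)).1
      obtain ⟨x, hx⟩ := this
      have hA := isCellComplement_complement hx
      have hcard := hA.card_nonDegenerate
      have h1 := ihc (complement x) (by omega)
      convert hA.cellAttachment.hasEulerData h1 hcollar using 1
      rw [eulerSum, eulerSum, Finset.sum_range_succ, Finset.sum_range_succ, hcard]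
      have := hA.eulerSum_eq
      rw [eulerSum, eulerSum] at this
      rw [this]
      push_cast
      ring

end Euler

end SSet

end

/-! ### The sets of even and odd simplices, and the conclusion. -/

section

open CategoryTheory Limits Opposite Topology

lemma card_sigma_of_isEmpty {T : ℕ → Type} [∀ k, Finite (T k)] {N : ℕ}
    (h : ∀ k, N ≤ k → IsEmpty (T k)) :
    Finite (Σ k, T k) ∧ Nat.card (Σ k, T k) = ∑ k ∈ Finset.range N, Nat.card (T k) := by
  let f : (Σ k : Fin N, T k) ≃ Σ k, T k :=
    { toFun x := ⟨x.1, x.2⟩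
      invFun x := ⟨⟨x.1, not_le.1 fun hx => (h x.1 hx).false x.2⟩, x.2⟩
      left_inv _ := rfl
      right_inv _ := rfl }
  refine ⟨Finite.of_equiv _ f, ?_⟩
  rw [← Nat.card_congr f, Nat.card_sigma, Fin.sum_univ_eq_sum_range fun k => Nat.card (T k)]

/-- The apex of `ζ^{(k)}` is the set of nondegenerate `k`-simplices. -/
noncomputable def zetaNondegApexEquiv (S : SSet.{0}) : (k : ℕ) →
    (zetaNondeg S k).apex ≃ S.nonDegenerate k
  | 0 => ((Equiv.setCongr S.nondegenerate_zero).trans (Equiv.Set.univ _)).symm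
  | _ + 1 => Equiv.refl _

/-- The total space of a functional is its apex. -/
def ObjFunctional.totalEquiv {B : Type} (F : ObjFunctional B) : F.total ≃ F.apex :=
  Equiv.sigmaFiberEquiv F.leg

lemma card_total_sum_zetaNondeg (S : SSet.{0}) [S.Finite] (a : ℕ → ℕ) {D N : ℕ}
    [S.HasDimensionLT D] (ha : ∀ k, N ≤ k → D ≤ a k) :
    Finite (ObjFunctional.sum fun k => zetaNondeg S (a k)).total ∧
      Nat.card (ObjFunctional.sum fun k => zetaNondeg S (a k)).total =
        ∑ k ∈ Finset.range N, Nat.card (S.nonDegenerate (a k)) := by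
  let e := (ObjFunctional.sum fun k => zetaNondeg S (a k)).totalEquiv.trans
    (Equiv.sigmaCongrRight fun k => zetaNondegApexEquiv S (a k))
  have h := card_sigma_of_isEmpty (T := fun k => S.nonDegenerate (a k)) (N := N) fun k hk =>
    ⟨fun y => absurd (S.dim_lt_of_nonDegenerate y D) (not_lt.2 (ha k hk))⟩
  have := h.1
  exact ⟨Finite.of_equiv _ e.symm, (Nat.card_congr e).trans h.2⟩

lemma SSet.eulerSum_two_mul (S : SSet.{0}) (N : ℕ) : eulerSum S (2 * N) =
    (∑ k ∈ Finset.range N, Nat.card (S.nonDegenerate (2 * k)) : ℕ) -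
      (∑ k ∈ Finset.range N, Nat.card (S.nonDegenerate (2 * k + 1)) : ℕ) := by
  induction N with
  | zero => rfl
  | succ N ih =>
    have h : eulerSum S (2 * (N + 1)) = eulerSum S (2 * N) +
        (-1) ^ (2 * N) * (Nat.card (S.nonDegenerate (2 * N)) : ℤ) +
        (-1) ^ (2 * N + 1) * (Nat.card (S.nonDegenerate (2 * N + 1)) : ℤ) :=
      (Finset.sum_range_succ _ _).trans (congrArg (· + _) (Finset.sum_range_succ _ _))
    rw [h, ih, Finset.sum_range_succ, Finset.sum_range_succ, (even_two_mul N).neg_one_pow,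
      (odd_two_mul_add_one N).neg_one_pow]
    push_cast
    ring

lemma HasEulerData.eulerCharacteristic_eq {X : Type} [TopologicalSpace X] {e : ℤ}
    (h : HasEulerData ℤ X e) : HasEulerChar X ∧ eulerCharacteristic X = e := by
  obtain ⟨hf, N, h0, hs⟩ := h
  have hsub (n : ℕ) (hn : N ≤ n) : Subsingleton (singularH X n) := h0 n hn
  refine ⟨⟨fun n => ?_, (Set.finite_lt_nat N).subset fun n hn => ?_⟩, ?_⟩
  · exact hf n
  · by_contra hn'
    exact (not_nontrivial_iff_subsingleton.2 (hsub n (not_lt.1 hn'))) hn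
  · rw [eulerCharacteristic, finsum_eq_sum_of_support_subset (s := Finset.range N)]
    · exact hs
    · intro n hn
      by_contra hn'
      have := hsub n (not_lt.1 fun h' => hn' (Finset.mem_coe.2 (Finset.mem_range.2 h')))
      refine hn ?_
      simp [Module.finrank_zero_of_subsingleton]

end

theorem proposition5p1 (X : Type) [TopologicalSpace X] [T2Space X]
    [Topology.CWComplex (Set.univ : Set X)]
    [Topology.RelCWComplex.Finite (Set.univ : Set X)]
    (S : SSet.{0}) [S.Finite]
    (hS : Nonempty (ContinuousMap.HomotopyEquiv (SSet.toTop.obj S) X)) :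
    HasEulerChar X ∧ Finite (EEven S) ∧ Finite (EOdd S) ∧
      eulerCharacteristic X = (Nat.card (EEven S) : ℤ) - (Nat.card (EOdd S) : ℤ) := by
  obtain ⟨f⟩ := hS
  obtain ⟨D, hD⟩ := S.hasDimensionLT_of_finite
  -- With the bound doubled, the sum over dimensions below `2 * D` splits into `D` even and `D` odd
  -- terms.
  have := S.hasDimensionLT_of_le D (2 * D)
  obtain ⟨h, h'⟩ := ((SSet.hasEulerData_toTop (R := ℤ) (2 * D) S).of_homotopyEquiv
    f).eulerCharacteristic_eq
  obtain ⟨h1, h2⟩ := card_total_sum_zetaNondeg S (fun k => 2 * k) (D := D) (N := D)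
    fun k hk => by omega
  obtain ⟨h3, h4⟩ := card_total_sum_zetaNondeg S (fun k => 2 * k + 1) (D := D) (N := D)
    fun k hk => by omega
  refine ⟨h, h1, h3, ?_⟩
  rw [h', SSet.eulerSum_two_mul, ← h2, ← h4]
  rfl
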